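/- **Setting.** Fix $G,\gamma,\ell_o>0$ and put $k=8\pi G$. Connections live on the trivial bundle over $\mathbb R^3$, with components taken in the basis $\tau_i=-\frac i2\sigma_i$. Let $\mathring A^i_a\neq 0$ be a smooth $\mathrm{SU}(2)$ connection invariant under the Euclidean group (acting by $y\mapsto ry+x$ together with the constant gauge rotation $r$). Let $\mathring e^a_i$ be the triad with $\mathring e^a_i\mathring A^j_a=\ell_o^{-1}\delta^j_i$, let $\mathring q$ be its metric, and put $\tilde E(p)=p\,\ell_o^{-2}\sqrt{\mathring q}\,\mathring e$. The symmetric phase space points are $(c\mathring A,\tilde E(p))$ with $c,p\in\mathbb R$. Write $r(c)=c\mathring A$. *Loop quantum gravity.* $\overline{\mathcal A}$ (resp. $\overline{\mathcal A}^{\mathbb C}$) is the space of generalized $\mathrm{SU}(2)$ (resp. $\mathrm{SL}(2,\mathbb C)$) connections, i.e. maps $A$ from piecewise analytic curves to the group with $A(e_2\circ e_1)=A(e_2)A(e_1)$ and $A(e^{-1})=A(e)^{-1}$; a smooth connection is identified with its holonomies. Let $\mu^o$ be the Ashtekar–Lewandowski measure and $\mathcal H=L^2(\overline{\mathcal A},\mu^o)$.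 $\underline{\mathrm{Cyl}}$ is the space of functions $f(A(e_1),\dots,A(e_n))$ with $e_1,\dots,e_n$ straight edges and $f:\mathrm{SU}(2)^n\to\mathbb C$ real analytic. A holomorphic cylindrical function is a function $\tilde F(\mathfrak Z(e_1),\dots,\mathfrak Z(e_n))$ on $\overline{\mathcal A}^{\mathbb C}$ with $e_i$ straight and $\tilde F:\mathrm{SL}(2,\mathbb C)^n\to\mathbb C$ holomorphic. *Loop quantum cosmology.* $\mathrm{Cyl}_S=r^*[\underline{\mathrm{Cyl}}]$, a space of almost periodic functions of $c\in\mathbb R$, inside $\mathcal H_S=L^2(\overline{\mathbb R}_{Bohr})$ with orthonormal basis $e^{i\mu c/2}$, $\mu\in\mathbb R$; and $\hat p=-i\frac{k\gamma}{3}\frac{d}{dc}$. *Complexifiers.* Let $C=C(\tilde E)\ge 0$ and $C_S=C_S(p)\ge 0$ be pure momentum complexifiers, $C_S$ differentiable, such that $\frac{\delta C}{\delta\tilde E}$ exists as a smooth one-form at every $\tilde E(p)$, and such that $\frac{\delta C}{\delta\tilde E}(\tilde E(p))$ and $C_S'(p)$ each vanish if and only if $p=0$. Let $\hat C$ be a non-negative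 self-adjoint operator on $\mathcal H$ and $\hat C_S=C_S(\hat p)$. Put $z=c-i\frac{k\gamma}{3}C_S'(p)$ and $\mathfrak Z=c\mathring A-ik\gamma\frac{\delta C}{\delta\tilde E}(\tilde E(p))$. Assume that $s$ is a holomorphic map from $\mathbb C$ to smooth $\mathrm{SL}(2,\mathbb C)$ connections (holomorphic componentwise at each point of space) with $s(z[\xi])=\mathfrak Z[\xi]$ at every symmetric phase space point $\xi$. *Operators, each on its natural domain.* - $U\Phi$, for $\Phi\in\underline{\mathrm{Cyl}}$, is the holomorphic cylindrical function that extends $e^{-\hat C}\Phi$. - $U_S\phi$, for $\phi\in\mathrm{Cyl}_S$, is the entire function that extends $e^{-\hat C_S}\phi\in\mathrm{Cyl}_S$. - $F(\hat{\mathfrak Z})$ is defined by $U(F(\hat{\mathfrak Z})\Phi)=F\cdot U\Phi$, and $F(s(\hat z))$ by $U_S(F(s(\hat z))\phi)=(F\circ s)\cdot U_S\phi$. - $\pi=U_S^{-1}\circ s^*\circ U:\underline{\mathrm{Cyl}}\to\mathrm{Cyl}_S$. - The $b$-embedding is $\iota_b[\psi](\Phi)=\psi(\pi\Phi)$. - The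 dual action of an operator $T$ is $(T^*\Lambda)(\Phi)=\Lambda(T\Phi)$, defined where $T\Phi$ exists and lies in the domain of $\Lambda$. The dual action of $F(s(\hat z))$ is written $F(s(\hat z))^\dagger$. **Proposition.** Let $F$ be a holomorphic cylindrical function (of finitely many holonomies along straight edges). 1. $F\circ s$ is a holomorphic function of finitely many of the $e^{i\mu z/2}$, $\mu\in\mathbb R$; and $\pi$, $F(\hat{\mathfrak Z})$, $F(s(\hat z))$ are well-defined (single-valued, linear, partially defined) operators. 2. The $b$-embedding intertwines the dual actions: $$F(\hat{\mathfrak Z})^*\circ\iota_b=\iota_b\circ F(s(\hat z))^\dagger .$$ That is, for every $\psi$ in the algebraic dual $\mathrm{Cyl}_S^*$ and every $\Phi\in\underline{\mathrm{Cyl}}$ in the domains of $\pi$ and $F(\hat{\mathfrak Z})$, one side is defined at $\Phi$ if and only if the other is, and then $$\big(F(\hat{\mathfrak Z})^*\iota_b[\psi]\big)(\Phi)=\iota_b\big[F(s(\hat z))^\dagger\psi\big](\Phi).$$ 3. If $U\Phi$ exists and is a polynomial in matrix entries of holonomies along straight edges, then $\Phi$ is in the domain of $\pi$, so that $\iota_b[\psi](\Phi)$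 is defined for every $\psi\in\mathrm{Cyl}_S^*$. If $F$ is also such a polynomial, then $\iota_b[F(s(\hat z))^\dagger\psi](\Phi)$ is defined as well. -/

import Mathlib

open scoped ContDiff

namespace LoopQG

noncomputable section

attribute [local instance] Matrix.normedAddCommGroup Matrix.normedSpace

/-- Space, the manifold carrying the (spatially flat) fields. -/
abbrev Space : Type := EuclideanSpace ℝ (Fin 3)

/-- Complex `2 × 2` matrices. -/
abbrev Mat : Type := Matrix (Fin 2) (Fin 2) ℂ

/-- The group `SU(2)` as a set of matrices. -/
def SU2 : Set Mat := (Matrix.specialUnitaryGroup (Fin 2) ℂ : Set Mat)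

/-- The group `SL(2,ℂ)` as a set of matrices. -/
def SL2 : Set Mat := {g | g.det = 1}

/-! ### Curves and straight edges -/

/-- A function restricts to a piecewise analytic curve on `[0,1]`: on each closed interval of a
partition it is real analytic up to the end points, with nowhere vanishing velocity. -/
def IsPiecewiseAnalytic (γ : ℝ → Space) : Prop :=
  ∃ (n : ℕ) (t : Fin (n + 1) → ℝ), StrictMono t ∧ t 0 = 0 ∧ t (Fin.last n) = 1 ∧
    ∀ i : Fin n, AnalyticOn ℝ γ (Set.Icc (t i.castSucc) (t i.succ)) ∧
      ∀ x ∈ Set.Icc (t i.castSucc) (t i.succ),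
        derivWithin γ (Set.Icc (t i.castSucc) (t i.succ)) x ≠ 0

/-- A parametrized piecewise analytic curve; only its values on `[0,1]` matter. -/
structure Curve where
  toFun : ℝ → Space
  piecewiseAnalytic : IsPiecewiseAnalytic toFun

/-- An oriented straight edge, given by its two (distinct) end points. -/
structure StraightEdge where
  src : Space
  tgt : Space
  ne : src ≠ tgt

/-- The straight edge as a curve `t ↦ src + t (tgt - src)`. -/
def StraightEdge.toCurve (e : StraightEdge) : Curve where
  toFun t := e.src + t • (e.tgt - e.src)
  piecewiseAnalytic := by
    refine ⟨1, ![0, 1], ?_, rfl, rfl, ?_⟩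
    · intro i j hij
      fin_cases i <;> fin_cases j <;> simp_all
    · intro i
      have hi : i = 0 := Subsingleton.elim _ _
      subst hi
      refine ⟨?_, ?_⟩
      · exact analyticOn_const.add (analyticOn_id.smul analyticOn_const)
      · intro x hx
        have hd : HasDerivAt (fun t : ℝ => e.src + t • (e.tgt - e.src)) (e.tgt - e.src) x := by
          simpa using ((hasDerivAt_id x).smul_const (e.tgt - e.src)).const_add e.src
        have hu : UniqueDiffWithinAt ℝ (Set.Icc (0 : ℝ) 1) x :=
          uniqueDiffOn_Icc zero_lt_one x hx
        have h := hd.hasDerivWithinAt.derivWithin hu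
        intro h0
        exact e.ne (sub_eq_zero.mp (h.symm.trans h0)).symm

/-! ### Generalized connections -/

/-- A generalized connection with structure group `S`: a map from piecewise analytic curves to `S`,
with no continuity requirement, that depends on the curve up to reparametrization only and
satisfies `A(e₂ ∘ e₁) = A(e₂) A(e₁)` and `A(e⁻¹) = A(e)⁻¹`. -/
@[ext]
structure GenConn (S : Set Mat) where
  toFun : Curve → Mat
  mem : ∀ γ, toFun γ ∈ S
  reparam : ∀ (γ γ' : Curve) (τ : ℝ → ℝ), ContinuousOn τ (Set.Icc 0 1) →
    StrictMonoOn τ (Set.Icc 0 1) → τ 0 = 0 → τ 1 = 1 →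
    (∃ P : Set ℝ, P.Finite ∧ ∀ t ∈ Set.Ioo (0 : ℝ) 1 \ P, DifferentiableAt ℝ τ t) →
    (∀ t ∈ Set.Icc (0 : ℝ) 1, γ'.toFun t = γ.toFun (τ t)) → toFun γ' = toFun γ
  comp : ∀ γ₁ γ₂ γ : Curve,
    (∀ t ∈ Set.Icc (0 : ℝ) (1 / 2), γ.toFun t = γ₁.toFun (2 * t)) →
    (∀ t ∈ Set.Icc (1 / 2 : ℝ) 1, γ.toFun t = γ₂.toFun (2 * t - 1)) →
    toFun γ = toFun γ₂ * toFun γ₁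
  inv : ∀ γ γ' : Curve, (∀ t ∈ Set.Icc (0 : ℝ) 1, γ'.toFun t = γ.toFun (1 - t)) →
    toFun γ' * toFun γ = 1

/-- Topology of pointwise convergence on the set of curves. -/
instance (S : Set Mat) : TopologicalSpace (GenConn S) :=
  TopologicalSpace.induced GenConn.toFun inferInstance

instance (S : Set Mat) : MeasurableSpace (GenConn S) := borel _

instance (S : Set Mat) : BorelSpace (GenConn S) := ⟨rfl⟩

/-- The trivial generalized connection. -/
def GenConn.trivial {S : Set Mat} (h : (1 : Mat) ∈ S) : GenConn S where
  toFun _ := 1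
  mem _ := h
  reparam := by intros; rfl
  comp := by intros; simp
  inv := by intros; simp

lemma one_mem_SU2 : (1 : Mat) ∈ SU2 := one_mem (Matrix.specialUnitaryGroup (Fin 2) ℂ)

lemma one_mem_SL2 : (1 : Mat) ∈ SL2 := by simp [SL2]

lemma SU2_subset_SL2 : SU2 ⊆ SL2 := fun _ hg => hg.2

/-- The inclusion of generalized `SU(2)` connections into generalized `SL(2,ℂ)` connections. -/
def GenConn.complexify (A : GenConn SU2) : GenConn SL2 where
  toFun := A.toFun
  mem γ := SU2_subset_SL2 (A.mem γ)
  reparam := A.reparam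
  comp := A.comp
  inv := A.inv

/-! ### Smooth connections and their holonomies -/

/-- The basis `τ_i = -(i/2) σ_i` of `su(2)`. -/
def tau : Fin 3 → Mat :=
  ![!![0, -Complex.I / 2; -Complex.I / 2, 0],
    !![0, -1 / 2; 1 / 2, 0],
    !![-Complex.I / 2, 0; 0, Complex.I / 2]]

/-- Real `su(2)`-valued one-forms `A^i_a(x)`, in components with respect to `τ_i`. -/
abbrev RealForm : Type := Space → Space →L[ℝ] Space

/-- `sl(2,ℂ)`-valued one-forms, in components with respect to `τ_i`. -/
abbrev ComplexForm : Type := Space → Space →L[ℝ] (Fin 3 → ℂ)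

/-- Smooth `SU(2)` connections on the trivial bundle over space. -/
def SmoothConn : Type := {A : RealForm // ContDiff ℝ ∞ A}

/-- Smooth `SL(2,ℂ)` connections on the trivial bundle over space. -/
def SmoothConnC : Type := {Z : ComplexForm // ContDiff ℝ ∞ Z}

/-- A real one-form regarded as a complex one. -/
def toComplexForm (A : RealForm) : ComplexForm := fun x =>
  (ContinuousLinearMap.pi fun i : Fin 3 =>
    Complex.ofRealCLM.comp (EuclideanSpace.proj i : Space →L[ℝ] ℝ)).comp (A x)

/-- `g` is the holonomy of `Z` along `γ`: the value at time `1` of the solution of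
`u' = Z(γ') u`, `u(0) = 1`. -/
def IsHolonomy (Z : ComplexForm) (γ : Curve) (g : Mat) : Prop :=
  ∃ u : ℝ → Mat, ContinuousOn u (Set.Icc 0 1) ∧ u 0 = 1 ∧ u 1 = g ∧
    ∃ P : Set ℝ, P.Finite ∧ ∀ t ∈ Set.Ioo (0 : ℝ) 1 \ P,
      HasDerivAt u ((∑ i, Z (γ.toFun t) (deriv γ.toFun t) i • tau i) * u t) t

open Classical in
/-- The generalized connection given by the holonomies of a one-form (for a smooth connection it
exists and is unique). -/
def holonomies {S : Set Mat} (h1 : (1 : Mat) ∈ S) (Z : ComplexForm) : GenConn S :=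
  if h : ∃ A : GenConn S, ∀ γ, IsHolonomy Z γ (A.toFun γ) then h.choose else GenConn.trivial h1

/-! ### Cylindrical functions -/

/-- Functions of finitely many holonomies along straight edges, analytic over `𝕜` in the
holonomies. A function on the submanifold `Sⁿ` of the space of `n`-tuples of matrices is analytic
when near each point of `Sⁿ` it is the restriction of a convergent power series in the matrix
entries. -/
def cyl (𝕜 : Type) [NontriviallyNormedField 𝕜] [NormedAlgebra 𝕜 ℂ] (S : Set Mat) :
    Submodule ℂ (GenConn S → ℂ) where
  carrier := {Φ | ∃ (n : ℕ) (e : Fin n → StraightEdge) (f : (Fin n → Mat) → ℂ),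
    AnalyticOn 𝕜 f {g | ∀ i, g i ∈ S} ∧ ∀ A, Φ A = f fun i => A.toFun (e i).toCurve}
  zero_mem' := ⟨0, Fin.elim0, 0, analyticOn_const, fun _ => rfl⟩
  add_mem' := by
    rintro Φ Ψ ⟨n, e, f, hf, hΦ⟩ ⟨m, e', f', hf', hΨ⟩
    refine ⟨n + m, Fin.append e e',
      fun g => f (fun i => g (Fin.castAdd m i)) + f' (fun i => g (Fin.natAdd n i)), ?_, ?_⟩
    · refine AnalyticOn.add ?_ ?_
      · let L : (Fin (n + m) → Mat) →L[𝕜] (Fin n → Mat) :=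
          ContinuousLinearMap.pi fun i => ContinuousLinearMap.proj (Fin.castAdd m i)
        exact hf.comp (L.analyticOn _) (fun g hg i => hg _)
      · let L : (Fin (n + m) → Mat) →L[𝕜] (Fin m → Mat) :=
          ContinuousLinearMap.pi fun i => ContinuousLinearMap.proj (Fin.natAdd n i)
        exact hf'.comp (L.analyticOn _) (fun g hg i => hg _)
    · intro A
      simp [hΦ, hΨ]
  smul_mem' := by
    rintro c Φ ⟨n, e, f, hf, hΦ⟩
    exact ⟨n, e, fun g => c * f g, analyticOn_const.mul hf, fun A => by simp [hΦ]⟩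

/-- Cylindrical functions of full loop quantum gravity based on straight edges: real analytic
functions on `SU(2)ⁿ` of finitely many holonomies. -/
abbrev Cyl : Submodule ℂ (GenConn SU2 → ℂ) := cyl ℝ SU2

/-- Holomorphic cylindrical functions based on straight edges: holomorphic functions on
`SL(2,ℂ)ⁿ` of finitely many holonomies. -/
abbrev HolCyl : Submodule ℂ (GenConn SL2 → ℂ) := cyl ℂ SL2

/-! ### The Ashtekar–Lewandowski measure and the kinematical Hilbert space -/

/-- The curves are the edges of a graph: analytic, embedded, and meeting only at end points. -/
def IsGraph {n : ℕ} (γ : Fin n → Curve) : Prop :=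
  (∀ i, AnalyticOn ℝ (γ i).toFun (Set.Icc 0 1) ∧ Set.InjOn (γ i).toFun (Set.Icc 0 1) ∧
    ∀ x ∈ Set.Icc (0 : ℝ) 1, derivWithin (γ i).toFun (Set.Icc 0 1) x ≠ 0) ∧
  ∀ i j, i ≠ j → ∀ s ∈ Set.Icc (0 : ℝ) 1, ∀ t ∈ Set.Icc (0 : ℝ) 1,
    (γ i).toFun s = (γ j).toFun t → (s = 0 ∨ s = 1) ∧ (t = 0 ∨ t = 1)

/-- The Ashtekar–Lewandowski measure: the regular faithful Borel probability measure for which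
the holonomies along the edges of any graph are distributed according to the normalized Haar
measure of `SU(2)ⁿ`, that is, have a left translation invariant law. -/
structure IsAshtekarLewandowski (μ : MeasureTheory.Measure (GenConn SU2)) : Prop where
  prob : MeasureTheory.IsProbabilityMeasure μ
  regular : μ.Regular
  faithful : μ.IsOpenPosMeasure
  haar : ∀ (n : ℕ) (γ : Fin n → Curve), IsGraph γ → ∀ g : Fin n → Mat, (∀ i, g i ∈ SU2) →
    ∀ f : (Fin n → Mat) → ℂ, Continuous f →
      ∫ A, f (fun i => g i * A.toFun (γ i)) ∂μ = ∫ A, f (fun i => A.toFun (γ i)) ∂μ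

/-- The kinematical Hilbert space `L²` over generalized `SU(2)` connections. -/
abbrev Hilb (μ : MeasureTheory.Measure (GenConn SU2)) : Type := MeasureTheory.Lp ℂ 2 μ

/-- `y = e^{-T} x` for a non-negative self-adjoint operator `T`, by the heat flow `u' = -T u`. -/
def IsExpNeg {H : Type*} [NormedAddCommGroup H] [InnerProductSpace ℂ H]
    (T : H →ₗ.[ℂ] H) (x y : H) : Prop :=
  ∃ u : ℝ → H, ContinuousOn u (Set.Ici 0) ∧ u 0 = x ∧ u 1 = y ∧
    ∀ t : ℝ, 0 < t → ∃ ht : u t ∈ T.domain, HasDerivAt u (-(T ⟨u t, ht⟩)) t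

/-- The graph of the transform `U` to the holomorphic representation: `(Φ, W)` belongs to it when
`W` is a holomorphic cylindrical function that extends `e^{-Ĉ} Φ` analytically from `SU(2)` to
`SL(2,ℂ)` connections. -/
def holTransform (μ : MeasureTheory.Measure (GenConn SU2)) (Chat : Hilb μ →ₗ.[ℂ] Hilb μ) :
    Submodule ℂ (Cyl × (GenConn SL2 → ℂ)) where
  carrier := {q | q.2 ∈ HolCyl ∧ ∃ h h' : Hilb μ, h =ᵐ[μ] (q.1 : GenConn SU2 → ℂ) ∧
    IsExpNeg Chat h h' ∧ h' =ᵐ[μ] fun A => q.2 A.complexify}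
  zero_mem' := by
    refine ⟨HolCyl.zero_mem, 0, 0, MeasureTheory.Lp.coeFn_zero _ _ _, ?_,
      MeasureTheory.Lp.coeFn_zero _ _ _⟩
    refine ⟨fun _ => 0, continuousOn_const, rfl, rfl, fun t _ => ⟨Chat.domain.zero_mem, ?_⟩⟩
    have h0 : Chat ⟨0, Chat.domain.zero_mem⟩ = 0 := Chat.map_zero
    rw [h0, neg_zero]
    exact hasDerivAt_const t 0
  add_mem' := by
    rintro ⟨Φ, W⟩ ⟨Φ₂, W₂⟩ ⟨hW, h, h', hh, ⟨u, hu, hu0, hu1, hud⟩, hh'⟩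
      ⟨hW₂, k, k', hk, ⟨v, hv, hv0, hv1, hvd⟩, hk'⟩
    refine ⟨HolCyl.add_mem hW hW₂, h + k, h' + k', ?_, ?_, ?_⟩
    · exact (MeasureTheory.Lp.coeFn_add h k).trans (hh.add hk)
    · refine ⟨fun t => u t + v t, hu.add hv, by simp [hu0, hv0], by simp [hu1, hv1], ?_⟩
      intro t ht
      obtain ⟨a, ha⟩ := hud t ht
      obtain ⟨b, hb⟩ := hvd t ht
      refine ⟨Chat.domain.add_mem a b, ?_⟩
      have e : Chat ⟨u t + v t, Chat.domain.add_mem a b⟩ = Chat ⟨u t, a⟩ + Chat ⟨v t, b⟩ :=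
        Chat.map_add ⟨u t, a⟩ ⟨v t, b⟩
      rw [e, neg_add]
      exact ha.add hb
    · exact (MeasureTheory.Lp.coeFn_add h' k').trans (hh'.add hk')
  smul_mem' := by
    rintro c ⟨Φ, W⟩ ⟨hW, h, h', hh, ⟨u, hu, hu0, hu1, hud⟩, hh'⟩
    refine ⟨HolCyl.smul_mem c hW, c • h, c • h', ?_, ?_, ?_⟩
    · exact (MeasureTheory.Lp.coeFn_smul c h).trans (hh.const_smul c)
    · refine ⟨fun t => c • u t, hu.const_smul c, by simp [hu0], by simp [hu1], ?_⟩
      intro t ht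
      obtain ⟨a, ha⟩ := hud t ht
      refine ⟨Chat.domain.smul_mem c a, ?_⟩
      have e : Chat ⟨c • u t, Chat.domain.smul_mem c a⟩ = c • Chat ⟨u t, a⟩ :=
        Chat.map_smul c ⟨u t, a⟩
      rw [e, ← smul_neg]
      exact ha.const_smul c
    · exact (MeasureTheory.Lp.coeFn_smul c h').trans (hh'.const_smul c)

/-- Given the graph `U` of a transform to functions on `X`, the graph of the operator that acts in
this representation as multiplication by `F`, on its natural domain. -/
def mulGraph {V X : Type} [AddCommGroup V] [Module ℂ V] (U : Submodule ℂ (V × (X → ℂ)))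
    (F : X → ℂ) : Submodule ℂ (V × V) where
  carrier := {q | ∃ W, (q.1, W) ∈ U ∧ (q.2, F * W) ∈ U}
  zero_mem' := ⟨0, U.zero_mem, by rw [mul_zero]; exact U.zero_mem⟩
  add_mem' := by
    rintro p q ⟨W, h1, h2⟩ ⟨W', h1', h2'⟩
    exact ⟨W + W', U.add_mem h1 h1', by rw [mul_add]; exact U.add_mem h2 h2'⟩
  smul_mem' := by
    rintro c p ⟨W, h1, h2⟩
    exact ⟨c • W, U.smul_mem c h1, by rw [mul_smul_comm]; exact U.smul_mem c h2⟩

/-- The operator `F(𝔷̂)` on `Cyl`: `U (F(𝔷̂) Φ) = F · U Φ`. -/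
def quantized (μ : MeasureTheory.Measure (GenConn SU2)) (Chat : Hilb μ →ₗ.[ℂ] Hilb μ)
    (F : GenConn SL2 → ℂ) : Cyl →ₗ.[ℂ] Cyl :=
  (mulGraph (holTransform μ Chat) F).toLinearPMap

/-! ### The homogeneous isotropic sector -/

/-- Invariance of a connection under the Euclidean group, which acts through the diffeomorphisms
`y ↦ r y + x` combined with the constant gauge rotation `r`. -/
def IsEuclideanInvariant (A : RealForm) : Prop :=
  ∀ r : Space ≃ₗᵢ[ℝ] Space, LinearMap.det (r.toLinearEquiv : Space →ₗ[ℝ] Space) = 1 →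
    ∀ x y v : Space, A (r y + x) (r v) = r (A y v)

/-- The connection `c Å` for complex `c`, as a one-form. -/
def scaledForm (A₀ : SmoothConn) (c : ℂ) : ComplexForm := fun x => c • toComplexForm A₀.1 x

/-- The map `r : c ↦ c Å`, through holonomies. -/
def symmConn (A₀ : SmoothConn) (c : ℝ) : GenConn SU2 :=
  holonomies one_mem_SU2 (scaledForm A₀ c)

/-- Cylindrical functions of loop quantum cosmology: the pull-backs under `r` of the cylindrical
functions based on straight edges. -/
def CylS (A₀ : SmoothConn) : Submodule ℂ (ℝ → ℂ) :=
  Cyl.map (LinearMap.funLeft ℂ ℂ (symmConn A₀))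

/-- The reference triad `e` with `e^a_i Å^j_a = ℓ⁻¹ δ^j_i`. -/
def refTriad (ℓ : ℝ) (A₀ : SmoothConn) : RealForm := fun x => ℓ⁻¹ • (A₀.1 x).inverse

/-- Square root of the determinant of the metric whose orthonormal frame is `refTriad`; its
co-triad is `ℓ Å`. -/
def refSqrtDet (ℓ : ℝ) (A₀ : SmoothConn) (x : Space) : ℝ :=
  |LinearMap.det ((ℓ • A₀.1 x : Space →L[ℝ] Space) : Space →ₗ[ℝ] Space)|

/-- The symmetric densitized triad `p ℓ⁻² √q e^a_i`; it maps the index `i` to the index `a`. -/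
def symmTriad (ℓ : ℝ) (A₀ : SmoothConn) (p : ℝ) : RealForm := fun x =>
  (p * (ℓ ^ 2)⁻¹ * refSqrtDet ℓ A₀ x) • refTriad ℓ A₀ x

/-- The smooth one-form `η` is the functional derivative of `C` at the densitized triad `E`:
`d/dt C(E + t h) = ∫ η^i_a h^a_i` at `t = 0` for smooth compactly supported `h`. -/
def HasFunctionalDeriv (C : RealForm → ℝ) (E : RealForm) (η : SmoothConn) : Prop :=
  ∀ h : RealForm, ContDiff ℝ ∞ h → HasCompactSupport h →
    HasDerivAt (fun t : ℝ => C (E + t • h))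
      (∫ x, LinearMap.trace ℝ Space (((η.1 x).comp (h x) : Space →L[ℝ] Space) : Space →ₗ[ℝ] Space))
      0

/-- The complex coordinate `z = c - i (k γ / 3) C_S'(p)`, `k = 8 π G`, generated by the pure
momentum complexifier `C_S(p)`: complex conjugate of `∑ (iⁿ/n!) {c, C_S}_(n)`, where
`{c, p} = k γ / 3` and the terms with `n ≥ 2` vanish. -/
def zCoord (G γ : ℝ) (CS : ℝ → ℝ) (c p : ℝ) : ℂ :=
  c - Complex.I * (8 * Real.pi * G * γ / 3 * deriv CS p : ℝ)

/-- The complex connection `𝔷 = A - i k γ δC/δE`, `k = 8 π G`, generated by a pure momentum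
complexifier `C(E)`, at the symmetric point with connection `c Å` and `δC/δE = η`: complex
conjugate of `∑ (iⁿ/n!) {A, C}_(n)`, where `{A, E} = k γ δ` and the terms with `n ≥ 2` vanish. -/
def complexConn (G γ : ℝ) (A₀ : SmoothConn) (c : ℝ) (η : SmoothConn) : ComplexForm := fun x =>
  scaledForm A₀ c x - (Complex.I * (8 * Real.pi * G * γ : ℝ)) • toComplexForm η.1 x

/-- A map `s : ℂ → 𝒜^ℂ` is holomorphic: so are all its components at all points of space. -/
def IsHolomorphicMap (s : ℂ → SmoothConnC) : Prop :=
  ∀ (x v : Space) (i : Fin 3), Differentiable ℂ fun z => (s z).1 x v i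

/-! ### Holomorphic representation of loop quantum cosmology -/

/-- `a` is the coefficient of `φ` along `e^{iμc/2}`, i.e. the scalar product `⟨e^{iμc/2}, φ⟩` in
`L²` of the Bohr compactification of the line, given by the mean value over the line. -/
def IsBohrCoeff (φ : ℝ → ℂ) (μ : ℝ) (a : ℂ) : Prop :=
  (∀ T : ℝ, IntervalIntegrable φ MeasureTheory.volume (-T) T) ∧
  Filter.Tendsto (fun T : ℝ => ((2 * T : ℝ) : ℂ)⁻¹ *
    ∫ c in (-T)..T, Complex.exp (-(Complex.I * μ * c / 2)) * φ c) Filter.atTop (nhds a)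

lemma IsBohrCoeff.add {φ ψ : ℝ → ℂ} {μ : ℝ} {a b : ℂ}
    (ha : IsBohrCoeff φ μ a) (hb : IsBohrCoeff ψ μ b) : IsBohrCoeff (φ + ψ) μ (a + b) := by
  refine ⟨fun T => (ha.1 T).add (hb.1 T), (Filter.Tendsto.add ha.2 hb.2).congr fun T => ?_⟩
  rw [← mul_add, ← intervalIntegral.integral_add]
  · congr 2; ext c; simp [mul_add]
  · exact (ha.1 T).continuousOn_mul (Continuous.continuousOn (by fun_prop))
  · exact (hb.1 T).continuousOn_mul (Continuous.continuousOn (by fun_prop))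

lemma IsBohrCoeff.smul {φ : ℝ → ℂ} {μ : ℝ} {a : ℂ} (k : ℂ) (ha : IsBohrCoeff φ μ a) :
    IsBohrCoeff (k • φ) μ (k * a) := by
  refine ⟨fun T => (ha.1 T).smul k, (Filter.Tendsto.const_mul k ha.2).congr fun T => ?_⟩
  rw [mul_left_comm, ← intervalIntegral.integral_const_mul]
  congr 2; ext c; simp [mul_left_comm]

lemma isBohrCoeff_zero (μ : ℝ) : IsBohrCoeff 0 μ 0 :=
  ⟨fun _ => intervalIntegrable_const, by simp⟩

/-- `φ' = e^{-Ĉ_S} φ` for `Ĉ_S = C_S(p̂)`. The operator `p̂` acts as `-i (8πγG/3) d/dc`, so the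
orthonormal basis vector `e^{iμc/2}` is an eigenvector with eigenvalue `(8πγG/3) (μ/2)`. -/
def IsExpNegS (G γ : ℝ) (CS : ℝ → ℝ) (φ φ' : ℝ → ℂ) : Prop :=
  ∀ μ : ℝ, ∃ a : ℂ, IsBohrCoeff φ μ a ∧
    IsBohrCoeff φ' μ ((Real.exp (-CS (8 * Real.pi * γ * G / 3 * (μ / 2))) : ℝ) * a)

/-- The graph of the transform `U_S` to the holomorphic representation: `(φ, w)` belongs to it
when `w` is the entire function that extends `e^{-Ĉ_S} φ` analytically. -/
def holTransformS (G γ : ℝ) (A₀ : SmoothConn) (CS : ℝ → ℝ) :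
    Submodule ℂ (CylS A₀ × (ℂ → ℂ)) where
  carrier := {q | Differentiable ℂ q.2 ∧ (fun c : ℝ => q.2 c) ∈ CylS A₀ ∧
    IsExpNegS G γ CS (q.1 : ℝ → ℂ) fun c : ℝ => q.2 c}
  zero_mem' := by
    refine ⟨differentiable_const 0, (CylS A₀).zero_mem, fun μ => ⟨0, isBohrCoeff_zero μ, ?_⟩⟩
    rw [mul_zero]
    exact isBohrCoeff_zero μ
  add_mem' := by
    rintro p q ⟨h1, h2, h3⟩ ⟨k1, k2, k3⟩
    refine ⟨h1.add k1, (CylS A₀).add_mem h2 k2, fun μ => ?_⟩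
    obtain ⟨a, ha, ha'⟩ := h3 μ
    obtain ⟨b, hb, hb'⟩ := k3 μ
    refine ⟨a + b, ha.add hb, ?_⟩
    rw [mul_add]
    exact ha'.add hb'
  smul_mem' := by
    rintro k p ⟨h1, h2, h3⟩
    refine ⟨h1.const_smul k, (CylS A₀).smul_mem k h2, fun μ => ?_⟩
    obtain ⟨a, ha, ha'⟩ := h3 μ
    refine ⟨k * a, ha.smul k, ?_⟩
    rw [mul_left_comm]
    exact ha'.smul k

/-- The holomorphic functions of `z` that depend on `z` via finitely many `z(μ) = e^{iμz/2}`. -/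
def IsHolCylS (w : ℂ → ℂ) : Prop :=
  ∃ (n : ℕ) (μ : Fin n → ℝ) (f : (Fin n → ℂ) → ℂ), DifferentiableOn ℂ f {ζ | ∀ j, ζ j ≠ 0} ∧
    ∀ z, w z = f fun j => Complex.exp (Complex.I * μ j * z / 2)

/-- The operator `w(ẑ)` on `Cyl_S`: `U_S (w(ẑ) φ) = w · U_S φ`. -/
def quantizedS (G γ : ℝ) (A₀ : SmoothConn) (CS : ℝ → ℝ) (w : ℂ → ℂ) :
    CylS A₀ →ₗ.[ℂ] CylS A₀ :=
  (mulGraph (holTransformS G γ A₀ CS) w).toLinearPMap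

/-! ### The `b`-embedding -/

/-- The map `s`, through holonomies. -/
def viaHolonomies (s : ℂ → SmoothConnC) (z : ℂ) : GenConn SL2 := holonomies one_mem_SL2 (s z).1

/-- The graph of `π = U_S⁻¹ ∘ s^* ∘ U` on its natural domain. -/
def bProjGraph (G γ : ℝ) (A₀ : SmoothConn) (μ : MeasureTheory.Measure (GenConn SU2))
    (Chat : Hilb μ →ₗ.[ℂ] Hilb μ) (CS : ℝ → ℝ) (s : ℂ → SmoothConnC) :
    Submodule ℂ (Cyl × CylS A₀) where
  carrier := {q | ∃ W, (q.1, W) ∈ holTransform μ Chat ∧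
    (q.2, W ∘ viaHolonomies s) ∈ holTransformS G γ A₀ CS}
  zero_mem' := ⟨0, (holTransform μ Chat).zero_mem, (holTransformS G γ A₀ CS).zero_mem⟩
  add_mem' := by
    rintro p q ⟨W, h1, h2⟩ ⟨W', h1', h2'⟩
    exact ⟨W + W', (holTransform μ Chat).add_mem h1 h1', (holTransformS G γ A₀ CS).add_mem h2 h2'⟩
  smul_mem' := by
    rintro c p ⟨W, h1, h2⟩
    exact ⟨c • W, (holTransform μ Chat).smul_mem c h1, (holTransformS G γ A₀ CS).smul_mem c h2⟩

/-- The projector `π = U_S⁻¹ ∘ s^* ∘ U` from `Cyl` to `Cyl_S`. -/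
def bProj (G γ : ℝ) (A₀ : SmoothConn) (μ : MeasureTheory.Measure (GenConn SU2))
    (Chat : Hilb μ →ₗ.[ℂ] Hilb μ) (CS : ℝ → ℝ) (s : ℂ → SmoothConnC) : Cyl →ₗ.[ℂ] CylS A₀ :=
  (bProjGraph G γ A₀ μ Chat CS s).toLinearPMap

/-- The dual action `Λ ↦ Λ ∘ T` of a partially defined linear map on (partially defined) linear
functionals, with the natural domain `{v ∈ dom T | T v ∈ dom Λ}`. -/
def dualAct {V W : Type} [AddCommGroup V] [Module ℂ V] [AddCommGroup W] [Module ℂ W]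
    (T : V →ₗ.[ℂ] W) (Λ : W →ₗ.[ℂ] ℂ) : V →ₗ.[ℂ] ℂ where
  domain := (Λ.domain.comap T.toFun).map T.domain.subtype
  toFun :=
    { toFun := fun v => Λ ⟨T ⟨v, by obtain ⟨x, -, h⟩ := v.2; rw [← h]; exact x.2⟩, by
        obtain ⟨v, x, hx, rfl⟩ := v; exact hx⟩
      map_add' := fun v w => by
        rw [← Λ.map_add]; congr 1; ext1; exact T.map_add ⟨v, _⟩ ⟨w, _⟩
      map_smul' := fun c v => by
        rw [RingHom.id_apply, ← Λ.map_smul]; congr 1; ext1; exact T.map_smul c ⟨v, _⟩ }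

/-- The `b`-embedding `ι_b`, `(ι_b ψ)(Φ) = ψ(π Φ)`. -/
def bEmbed (G γ : ℝ) (A₀ : SmoothConn) (μ : MeasureTheory.Measure (GenConn SU2))
    (Chat : Hilb μ →ₗ.[ℂ] Hilb μ) (CS : ℝ → ℝ) (s : ℂ → SmoothConnC)
    (ψ : CylS A₀ →ₗ.[ℂ] ℂ) : Cyl →ₗ.[ℂ] ℂ :=
  dualAct (bProj G γ A₀ μ Chat CS s) ψ

/-- Polynomials in the matrix entries of finitely many holonomies along straight edges. -/
def IsPolyCyl (W : GenConn SL2 → ℂ) : Prop :=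
  ∃ (n : ℕ) (e : Fin n → StraightEdge) (P : MvPolynomial (Fin n × Fin 2 × Fin 2) ℂ),
    ∀ A, W A = MvPolynomial.eval (fun k => A.toFun (e k.1).toCurve k.2.1 k.2.2) P

end

end LoopQG

open LoopQG

namespace LoopQG

noncomputable section

attribute [local instance] Matrix.normedAddCommGroup Matrix.normedSpace

/-! ### Linear matrix differential equations -/

/-! The intertwining relation rests on the multiplicativity of the pull-back: `s^*(F · UΦ) = (F ∘ s)
· s^*(UΦ)`. Both sides at `Φ` are `ψ` applied to the preimage of this function under `U_S`. The work
lies in showing that `U` and `U_S`, given as linear relations, are single-valued and injective, so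
that the operators are determined by their graphs; in part 3 also that enough functions lie in the
range of `U_S`.

The map `s` is known explicitly. At `p = 0` both momentum derivatives vanish, so `s(c) = c Å` for
real `c`, and the identity theorem gives `s(z) = z Å` (`eq_scaledForm`). Euclidean invariance forces
`Å` to be a constant multiple `a` of the identity (`eq_smul_of_isEuclideanInvariant`), so the
holonomy of `z Å` along a straight edge of length `L` is an explicit function of `exp(i a L z / 2)`
(`isHolonomy_straightEdge`). Hence `F ∘ s` depends on finitely many exponentials, and polynomials
pull back to trigonometric polynomials.

For `U`: the heat flow contracts norms, so the zero vector flows to zero, and it has backward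
uniqueness, so only zero flows to zero (`IsExpNeg.eq_zero_of_left`, `IsExpNeg.eq_zero_of_right`). A
holomorphic cylindrical function vanishing on `SU(2)` connections vanishes (`HolCyl.eq_zero`): its
edges are cut into the edges of a graph, whose holonomies are dense in `SU(2)ᵐ` by the Haar
property, and `SU(2)ᵐ` is a uniqueness set in `SL(2,ℂ)ᵐ` by the Cartan decomposition.

For `U_S`: an element of `Cyl_S` is a continuous function on a torus read along a line, and such a
function is zero when all its Bohr coefficients are (`eq_zero_of_isBohrCoeff_zero`). The multiplier
`exp(-C_S)` never vanishes, and each `e^{iνc/2}` lies in `Cyl_S`, so every trigonometric polynomial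
is in the range of `U_S` (`exists_holTransformS`). -/

lemma hasDerivAt_mat_iff {u : ℝ → Mat} {U : Mat} {t : ℝ} :
    HasDerivAt u U t ↔ ∀ i j, HasDerivAt (fun x => u x i j) (U i j) t := by
  refine Iff.trans (hasDerivAt_pi (φ := u) (φ' := U)) (forall_congr' fun i => ?_)
  exact hasDerivAt_pi (φ := fun x => u x i) (φ' := U i)

lemma HasDerivAt.mat_mul {u v : ℝ → Mat} {U V : Mat} {t : ℝ}
    (hu : HasDerivAt u U t) (hv : HasDerivAt v V t) :
    HasDerivAt (fun x => u x * v x) (U * v t + u t * V) t := by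
  rw [hasDerivAt_mat_iff] at *
  intro i j
  simp only [Matrix.mul_apply, Matrix.add_apply, ← Finset.sum_add_distrib]
  exact HasDerivAt.fun_sum fun k _ => (hu i k).mul (hv k j)

lemma HasDerivAt.mat_mul_const {u : ℝ → Mat} {U : Mat} {t : ℝ}
    (hu : HasDerivAt u U t) (B : Mat) : HasDerivAt (fun x => u x * B) (U * B) t := by
  simpa using HasDerivAt.mat_mul hu (hasDerivAt_const t B)

/-- In size two the adjugate is linear in the entries. -/
lemma HasDerivAt.mat_adjugate {u : ℝ → Mat} {U : Mat} {t : ℝ} (hu : HasDerivAt u U t) :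
    HasDerivAt (fun x => (u x).adjugate) U.adjugate t := by
  rw [hasDerivAt_mat_iff] at *
  intro i j
  fin_cases i <;> fin_cases j <;> simp only [Matrix.adjugate_fin_two]
  · exact hu 1 1
  · exact (hu 0 1).neg
  · exact (hu 1 0).neg
  · exact hu 0 0

lemma HasDerivAt.mat_conjTranspose {u : ℝ → Mat} {U : Mat} {t : ℝ} (hu : HasDerivAt u U t) :
    HasDerivAt (fun x => (u x).conjTranspose) U.conjTranspose t := by
  rw [hasDerivAt_mat_iff] at *
  intro i j
  exact (hu j i).star

lemma ContinuousOn.mat_mul {X : Type*} [TopologicalSpace X] {s : Set X} {u v : X → Mat}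
    (hu : ContinuousOn u s) (hv : ContinuousOn v s) : ContinuousOn (fun x => u x * v x) s :=
  (continuous_fst.matrix_mul continuous_snd).comp_continuousOn (hu.prodMk hv)

lemma adjugate_of_trace_eq_zero {M : Mat} (h : M.trace = 0) : M.adjugate = -M := by
  rw [Matrix.trace_fin_two] at h
  rw [Matrix.adjugate_fin_two]
  ext i j
  fin_cases i <;> fin_cases j <;> simp
  · linear_combination h
  · linear_combination h

/-- A function that is continuous on an interval and has vanishing derivative off a finite set is
constant. -/
lemma eq_of_hasDerivAt_zero_off_finite {E : Type*} [NormedAddCommGroup E] [NormedSpace ℝ E]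
    [CompleteSpace E] {f : ℝ → E} {a b : ℝ} (hc : ContinuousOn f (Set.Icc a b)) {P : Set ℝ}
    (hP : P.Finite) (hd : ∀ t ∈ Set.Ioo a b \ P, HasDerivAt f 0 t) {x : ℝ}
    (hx : x ∈ Set.Icc a b) : f x = f a := by
  have h := MeasureTheory.integral_eq_of_hasDerivAt_off_countable_of_le f (fun _ => 0) hx.1
    hP.countable (hc.mono (Set.Icc_subset_Icc_right hx.2))
    (fun t ht => hd t ⟨⟨ht.1.1, ht.1.2.trans_le hx.2⟩, ht.2⟩) intervalIntegrable_const
  simp only [intervalIntegral.integral_zero] at h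
  exact (sub_eq_zero.mp h.symm)

/-- `u` is a continuous solution of `u' = M u` on `[a, b]`, where the equation may fail at finitely
many times. -/
def IsSolOn (M : ℝ → Mat) (a b : ℝ) (u : ℝ → Mat) : Prop :=
  ContinuousOn u (Set.Icc a b) ∧
    ∃ P : Set ℝ, P.Finite ∧ ∀ t ∈ Set.Ioo a b \ P, HasDerivAt u (M t * u t) t

/-- Since `adj M = -M` for traceless `M`, the two terms in the derivative of `adj(u) v` cancel. The
adjugate stands in for an inverse not yet known to exist: `v = u` yields `det u = 1`, and two
solutions yield uniqueness without a Gronwall estimate. -/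
lemma IsSolOn.adjugate_mul {M : ℝ → Mat} (hM : ∀ t, (M t).trace = 0) {a b : ℝ} {u v : ℝ → Mat}
    (hu : IsSolOn M a b u) (hv : IsSolOn M a b v) {t : ℝ} (ht : t ∈ Set.Icc a b) :
    (u t).adjugate * v t = (u a).adjugate * v a := by
  obtain ⟨hcu, P, hP, hdu⟩ := hu
  obtain ⟨hcv, Q, hQ, hdv⟩ := hv
  have hc : ContinuousOn (fun t => (u t).adjugate * v t) (Set.Icc a b) :=
    ContinuousOn.mat_mul ((Continuous.matrix_adjugate continuous_id).comp_continuousOn hcu) hcv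
  refine eq_of_hasDerivAt_zero_off_finite (E := Mat) hc (hP.union hQ) (fun x hx => ?_) ht
  have h1 := hdu x ⟨hx.1, fun h => hx.2 (Or.inl h)⟩
  have h2 := hdv x ⟨hx.1, fun h => hx.2 (Or.inr h)⟩
  refine (HasDerivAt.mat_mul (HasDerivAt.mat_adjugate h1) h2).congr_deriv ?_
  rw [Matrix.adjugate_mul_distrib, adjugate_of_trace_eq_zero (hM x)]
  simp [Matrix.mul_assoc]

lemma IsSolOn.det_eq_one {M : ℝ → Mat} (hM : ∀ t, (M t).trace = 0) {a b : ℝ} {u : ℝ → Mat}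
    (hu : IsSolOn M a b u) (h1 : u a = 1) {t : ℝ} (ht : t ∈ Set.Icc a b) : (u t).det = 1 := by
  have h := IsSolOn.adjugate_mul hM hu hu ht
  rw [Matrix.adjugate_mul, h1, Matrix.adjugate_one, one_mul] at h
  simpa using congrFun (congrFun h 0) 0

lemma IsSolOn.eq {M : ℝ → Mat} (hM : ∀ t, (M t).trace = 0) {a b : ℝ} {u v : ℝ → Mat}
    (hu : IsSolOn M a b u) (hv : IsSolOn M a b v) (hu1 : u a = 1) (hv1 : v a = 1) {t : ℝ}
    (ht : t ∈ Set.Icc a b) : u t = v t := by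
  have h := IsSolOn.adjugate_mul hM hu hv ht
  rw [hu1, hv1, Matrix.adjugate_one, one_mul] at h
  have h2 := congrArg (u t * ·) h
  simp only [← Matrix.mul_assoc, Matrix.mul_adjugate, hu.det_eq_one hM hu1 ht, one_smul, one_mul,
    mul_one] at h2
  exact h2.symm

/-- The same cancellation with the adjoint: the derivative is `u* (M* + M) u = 0`. -/
lemma IsSolOn.conjTranspose_mul_self {M : ℝ → Mat} (hM : ∀ t, (M t).conjTranspose = -M t)
    {a b : ℝ} {u : ℝ → Mat} (hu : IsSolOn M a b u) (h1 : u a = 1) {t : ℝ}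
    (ht : t ∈ Set.Icc a b) : (u t).conjTranspose * u t = 1 := by
  obtain ⟨hcu, P, hP, hdu⟩ := hu
  have hc : ContinuousOn (fun t => (u t).conjTranspose * u t) (Set.Icc a b) :=
    ContinuousOn.mat_mul ((Continuous.matrix_conjTranspose continuous_id).comp_continuousOn hcu)
      hcu
  have h := eq_of_hasDerivAt_zero_off_finite (E := Mat) hc hP (fun x hx => ?_) ht
  · simpa [h1] using h
  · refine (HasDerivAt.mat_mul (HasDerivAt.mat_conjTranspose (hdu x hx))
      (hdu x hx)).congr_deriv ?_
    rw [Matrix.conjTranspose_mul, hM]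
    simp [Matrix.mul_assoc]

/-- The equation `u' = M u`, `u(a) = 1` has a solution on `[a, b]`. -/
def HasSol (M : ℝ → Mat) (a b : ℝ) : Prop := ∃ u, IsSolOn M a b u ∧ u a = 1

/-- Right multiplication by a constant preserves the equation, so a solution restarted at the
identity is continued by `v * u b`. The junction `b` joins the exceptional times. -/
lemma IsSolOn.glue {M : ℝ → Mat} {a b c : ℝ} (hab : a ≤ b) (hbc : b ≤ c) {u v : ℝ → Mat}
    (hu : IsSolOn M a b u) (hv : IsSolOn M b c v) (hv1 : v b = 1) :
    IsSolOn M a c (fun t => if t ≤ b then u t else v t * u b) := by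
  obtain ⟨hcu, P, hP, hdu⟩ := hu
  obtain ⟨hcv, Q, hQ, hdv⟩ := hv
  refine ⟨?_, insert b (P ∪ Q), (hP.union hQ).insert b, ?_⟩
  · rw [← Set.Icc_union_Icc_eq_Icc hab hbc]
    refine ContinuousOn.union_of_isClosed ?_ ?_ isClosed_Icc isClosed_Icc
    · exact hcu.congr fun t ht => if_pos ht.2
    · refine (ContinuousOn.mat_mul hcv continuousOn_const).congr (f := fun t => v t * u b)
        fun t ht => ?_
      rcases ht.1.eq_or_lt with rfl | h
      · simp [hv1]
      · simp [not_le.mpr h]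
  · rintro t ⟨ht, hn⟩
    simp only [Set.mem_insert_iff, Set.mem_union, not_or] at hn
    rcases lt_or_gt_of_ne hn.1 with h | h
    · have := hdu t ⟨⟨ht.1, h⟩, hn.2.1⟩
      simp only [h.le, if_true]
      refine this.congr_of_eventuallyEq ?_
      filter_upwards [eventually_lt_nhds h] with x hx
      simp [hx.le]
    · have := HasDerivAt.mat_mul_const (hdv t ⟨⟨h, ht.2⟩, hn.2.2⟩) (u b)
      simp only [not_le.mpr h, if_false]
      rw [← Matrix.mul_assoc]
      refine this.congr_of_eventuallyEq ?_
      filter_upwards [eventually_gt_nhds h] with x hx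
      simp [not_le.mpr hx]

lemma HasSol.trans {M : ℝ → Mat} {a b c : ℝ} (hab : a ≤ b) (hbc : b ≤ c) (h : HasSol M a b)
    (h' : HasSol M b c) : HasSol M a c := by
  obtain ⟨u, hu, hu1⟩ := h
  obtain ⟨v, hv, hv1⟩ := h'
  exact ⟨_, hu.glue hab hbc hv hv1, by simp [hab, hu1]⟩

lemma HasSol.congr {M M' : ℝ → Mat} {a b : ℝ} (h : HasSol M a b)
    (hM : ∀ t ∈ Set.Ioo a b, M t = M' t) : HasSol M' a b := by
  obtain ⟨u, ⟨hc, P, hP, hd⟩, hu1⟩ := h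
  exact ⟨u, ⟨hc, P, hP, fun t ht => hM t ht.1 ▸ hd t ht⟩, hu1⟩

lemma norm_mat_mul_le (A B : Mat) : ‖A * B‖ ≤ 2 * ‖A‖ * ‖B‖ := by
  rw [Matrix.norm_le_iff (by positivity)]
  intro i j
  rw [Matrix.mul_apply, Fin.sum_univ_two]
  have h : ∀ k, ‖A i k * B k j‖ ≤ ‖A‖ * ‖B‖ := fun k => by
    rw [norm_mul]
    exact mul_le_mul (Matrix.norm_entry_le_entrywise_sup_norm A)
      (Matrix.norm_entry_le_entrywise_sup_norm B) (norm_nonneg _) (norm_nonneg _)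
  linarith [norm_add_le (A i 0 * B 0 j) (A i 1 * B 1 j), h 0, h 1]

/-- Picard–Lindelöf on the unit ball around the identity, where the velocity is at most `K (‖1‖ +
1)`; the last hypothesis keeps the solution in that ball. The factor 2 in `hK` appears because the
entrywise sup norm is submultiplicative only up to the matrix size. -/
lemma hasSol_of_small {M : ℝ → Mat} {a b : ℝ} (hab : a ≤ b) (hM : ContinuousOn M (Set.Icc a b))
    {K : ℝ} (hK0 : 0 ≤ K) (hK : ∀ t ∈ Set.Icc a b, 2 * ‖M t‖ ≤ K)
    (hs : K * (‖(1 : Mat)‖ + 1) * (b - a) ≤ 1) : HasSol M a b := by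
  have hPL : IsPicardLindelof (fun t x => M t * x) (tmin := a) (tmax := b)
      ⟨a, Set.left_mem_Icc.mpr hab⟩ (1 : Mat) 1 0
      ⟨K * (‖(1 : Mat)‖ + 1), by positivity⟩ ⟨K, hK0⟩ := by
    refine ⟨fun t ht => ?_, fun x _ => ContinuousOn.mat_mul hM continuousOn_const, fun t ht x hx => ?_, ?_⟩
    · refine LipschitzOnWith.of_dist_le_mul fun x _ y _ => ?_
      rw [dist_eq_norm, dist_eq_norm, ← Matrix.mul_sub]
      refine (norm_mat_mul_le _ _).trans ?_
      exact mul_le_mul_of_nonneg_right (hK t ht) (norm_nonneg _)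
    · refine (norm_mat_mul_le _ _).trans ?_
      have hx' : ‖x‖ ≤ ‖(1 : Mat)‖ + 1 := by
        have : ‖x - 1‖ ≤ 1 := by simpa [dist_eq_norm] using hx
        linarith [norm_le_insert' x 1]
      exact mul_le_mul (hK t ht) hx' (norm_nonneg _) hK0
    · simp only [NNReal.coe_one, NNReal.coe_zero, sub_zero, sub_self]
      rwa [max_eq_left (sub_nonneg.mpr hab)]
  obtain ⟨u, hu1, hu⟩ := hPL.exists_eq_forall_mem_Icc_hasDerivWithinAt₀
  refine ⟨u, ⟨fun t ht => (hu t ht).continuousWithinAt, ∅, Set.finite_empty, fun t ht => ?_⟩, hu1⟩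
  exact (hu t (Set.Ioo_subset_Icc_self ht.1)).hasDerivAt (Icc_mem_nhds ht.1.1 ht.1.2)

/-- Every piece restarts at the identity, so the admissible step length depends only on the bound
for `M`, and finitely many equal steps cover the interval. -/
lemma hasSol_of_continuousOn {M : ℝ → Mat} {a b : ℝ} (hab : a ≤ b)
    (hM : ContinuousOn M (Set.Icc a b)) : HasSol M a b := by
  obtain ⟨B, hB⟩ := isCompact_Icc.exists_bound_of_continuousOn hM
  have hB0 : 0 ≤ B := (norm_nonneg _).trans (hB a (Set.left_mem_Icc.mpr hab))
  obtain ⟨N, hN⟩ := exists_nat_gt (2 * B * (‖(1 : Mat)‖ + 1) * (b - a))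
  have hNpos : (0 : ℝ) < N := lt_of_le_of_lt
    (mul_nonneg (by positivity) (sub_nonneg.mpr hab)) hN
  set h := (b - a) / N with hh
  have hh0 : 0 ≤ h := div_nonneg (sub_nonneg.mpr hab) hNpos.le
  have key : ∀ n : ℕ, n ≤ N → HasSol M a (a + n * h) := by
    intro n
    induction n with
    | zero =>
      intro _
      exact ⟨fun _ => 1, ⟨continuousOn_const, ∅, Set.finite_empty, fun t ht => by
        simp at ht⟩, rfl⟩
    | succ n ih =>
      intro hn
      have e1 : a + n * h ≤ a + (n + 1 : ℕ) * h := by push_cast; nlinarith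
      have e0 : a ≤ a + n * h := by nlinarith [Nat.cast_nonneg (α := ℝ) n]
      have e2 : a + (n + 1 : ℕ) * h ≤ b := by
        have : ((n + 1 : ℕ) : ℝ) ≤ N := by exact_mod_cast hn
        have h3 : (N : ℝ) * h = b - a := by rw [hh]; field_simp
        nlinarith
      have hsub : Set.Icc (a + n * h) (a + (n + 1 : ℕ) * h) ⊆ Set.Icc a b :=
        Set.Icc_subset_Icc e0 e2
      refine (ih (by omega)).trans e0 e1
        (hasSol_of_small e1 (hM.mono hsub) (K := 2 * B) (by positivity)
        (fun t ht => by linarith [hB t (hsub ht)]) ?_)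
      have h4 : a + (n + 1 : ℕ) * h - (a + n * h) = h := by push_cast; ring
      rw [h4, hh, mul_div_assoc', div_le_one hNpos]
      exact hN.le
  have := key N le_rfl
  rwa [hh, mul_div_cancel₀ _ hNpos.ne', add_sub_cancel] at this

/-! ### Existence and uniqueness of holonomies -/

/-- The matrix `Z(v)` at the point `x`. -/
def formMat (Z : ComplexForm) (x v : Space) : Mat := ∑ i, Z x v i • tau i

/-- The coefficient `Z(γ')` of the parallel transport equation. -/
def velMat (Z : ComplexForm) (γ : Curve) (t : ℝ) : Mat := formMat Z (γ.toFun t) (deriv γ.toFun t)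

lemma trace_tau (i : Fin 3) : (tau i).trace = 0 := by
  fin_cases i <;> simp [tau, Matrix.trace_fin_two, neg_div]

lemma conjTranspose_tau (i : Fin 3) : (tau i).conjTranspose = -tau i := by
  fin_cases i <;> ext j k <;> fin_cases j <;> fin_cases k <;>
    simp [tau, Complex.ext_iff] <;> norm_num

lemma trace_formMat (Z : ComplexForm) (x v : Space) : (formMat Z x v).trace = 0 := by
  simp [formMat, Matrix.trace_sum, trace_tau]

lemma conjTranspose_formMat {Z : ComplexForm} (hZ : ∀ x v i, (Z x v i).im = 0) (x v : Space) :
    (formMat Z x v).conjTranspose = -formMat Z x v := by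
  have h : ∀ i, star (Z x v i) = Z x v i := fun i => Complex.conj_eq_iff_im.mpr (hZ x v i)
  simp only [formMat, Matrix.conjTranspose_sum, Matrix.conjTranspose_smul, conjTranspose_tau, h,
    smul_neg, Finset.sum_neg_distrib]

lemma formMat_smul (Z : ComplexForm) (x : Space) (r : ℝ) (v : Space) :
    formMat Z x (r • v) = r • formMat Z x v := by
  simp only [formMat, map_smul, Finset.smul_sum, Pi.smul_apply, smul_assoc]

lemma isHolonomy_iff {Z : ComplexForm} {γ : Curve} {g : Mat} :
    IsHolonomy Z γ g ↔ ∃ u, IsSolOn (velMat Z γ) 0 1 u ∧ u 0 = 1 ∧ u 1 = g :=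
  ⟨fun ⟨u, h1, h2, h3, h4⟩ => ⟨u, ⟨h1, h4⟩, h2, h3⟩,
    fun ⟨u, ⟨h1, h4⟩, h2, h3⟩ => ⟨u, h1, h2, h3, h4⟩⟩

lemma IsHolonomy.unique {Z : ComplexForm} {γ : Curve} {g g' : Mat} (h : IsHolonomy Z γ g)
    (h' : IsHolonomy Z γ g') : g = g' := by
  obtain ⟨u, hu, hu0, rfl⟩ := isHolonomy_iff.mp h
  obtain ⟨v, hv, hv0, rfl⟩ := isHolonomy_iff.mp h'
  exact hu.eq (fun t => trace_formMat Z _ _) hv hu0 hv0 (by simp)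

lemma IsHolonomy.mem_SL2 {Z : ComplexForm} {γ : Curve} {g : Mat} (h : IsHolonomy Z γ g) :
    g ∈ SL2 := by
  obtain ⟨u, hu, hu0, rfl⟩ := isHolonomy_iff.mp h
  exact hu.det_eq_one (fun t => trace_formMat Z _ _) hu0 (by simp)

lemma IsHolonomy.mem_SU2 {Z : ComplexForm} (hZ : ∀ x v i, (Z x v i).im = 0) {γ : Curve} {g : Mat}
    (h : IsHolonomy Z γ g) : g ∈ SU2 := by
  refine Matrix.mem_specialUnitaryGroup_iff.mpr ⟨?_, h.mem_SL2⟩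
  obtain ⟨u, hu, hu0, rfl⟩ := isHolonomy_iff.mp h
  exact Matrix.mem_unitaryGroup_iff'.mpr
    (hu.conjTranspose_mul_self (fun t => conjTranspose_formMat hZ _ _) hu0 (by simp))

lemma Curve.exists_finite_differentiableAt (γ : Curve) :
    ∃ P : Set ℝ, P.Finite ∧ ∀ t ∈ Set.Ioo (0 : ℝ) 1 \ P, DifferentiableAt ℝ γ.toFun t := by
  obtain ⟨n, t, hmono, h0, h1, h⟩ := γ.piecewiseAnalytic
  have key : ∀ k : ℕ, ∀ hk : k < n + 1, ∃ P : Set ℝ, P.Finite ∧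
      ∀ x ∈ Set.Ioo (0 : ℝ) (t ⟨k, hk⟩) \ P, DifferentiableAt ℝ γ.toFun x := by
    intro k
    induction k with
    | zero =>
      intro hk
      refine ⟨∅, Set.finite_empty, fun x hx => ?_⟩
      have e : t ⟨0, hk⟩ = 0 := h0
      rw [e] at hx
      simp at hx
    | succ k ih =>
      intro hk
      obtain ⟨P, hP, hd⟩ := ih (by omega)
      refine ⟨insert (t ⟨k, by omega⟩) P, hP.insert _, fun x hx => ?_⟩
      obtain ⟨hx, hxP⟩ := hx
      simp only [Set.mem_insert_iff, not_or] at hxP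
      rcases lt_or_gt_of_ne hxP.1 with hlt | hgt
      · exact hd x ⟨⟨hx.1, hlt⟩, hxP.2⟩
      · have hA := (h ⟨k, by omega⟩).1
        exact (hA.differentiableOn x ⟨hgt.le, hx.2.le⟩).differentiableAt
          (Icc_mem_nhds hgt hx.2)
  obtain ⟨P, hP, hd⟩ := key n (by omega)
  refine ⟨P, hP, fun x hx => hd x ?_⟩
  have e : t ⟨n, by omega⟩ = 1 := h1
  rwa [e]

lemma hasSol_velMat {Z : ComplexForm} (hZ : Continuous Z) (γ : Curve) :
    HasSol (velMat Z γ) 0 1 := by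
  obtain ⟨n, t, hmono, h0, h1, h⟩ := γ.piecewiseAnalytic
  have key : ∀ k : ℕ, ∀ hk : k < n + 1, HasSol (velMat Z γ) 0 (t ⟨k, hk⟩) := by
    intro k
    induction k with
    | zero =>
      intro hk
      have e : t ⟨0, hk⟩ = 0 := h0
      rw [e]
      exact ⟨fun _ => 1, ⟨continuousOn_const, ∅, Set.finite_empty, fun t ht => by
        simp at ht⟩, rfl⟩
    | succ k ih =>
      intro hk
      have hlt : t ⟨k, by omega⟩ < t ⟨k + 1, hk⟩ := hmono (by simp)
      refine (ih (by omega)).trans (h0 ▸ hmono.monotone (Fin.zero_le _)) hlt.le ?_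
      have hA : AnalyticOn ℝ γ.toFun (Set.Icc (t ⟨k, by omega⟩) (t ⟨k + 1, hk⟩)) :=
        (h ⟨k, by omega⟩).1
      have hcd := (hA.contDiffOn (uniqueDiffOn_Icc hlt) (n := 1)).continuousOn_derivWithin
        (uniqueDiffOn_Icc hlt) le_rfl
      -- The one-sided derivative is continuous up to the break points, where `deriv` carries no
      -- information; the two agree in the interior of the piece.
      have hc : ContinuousOn (fun x => formMat Z (γ.toFun x) (derivWithin γ.toFun
          (Set.Icc (t ⟨k, by omega⟩) (t ⟨k + 1, hk⟩)) x))
          (Set.Icc (t ⟨k, by omega⟩) (t ⟨k + 1, hk⟩)) := by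
        have hv := (hZ.comp_continuousOn hA.continuousOn).clm_apply hcd
        refine continuousOn_finsetSum _ fun i _ => ?_
        exact (((continuous_apply i).comp_continuousOn hv)).smul continuousOn_const
      refine (hasSol_of_continuousOn hlt.le hc).congr fun x hx => ?_
      rw [velMat, derivWithin_of_mem_nhds (Icc_mem_nhds hx.1 hx.2)]
  have e : t ⟨n, by omega⟩ = 1 := h1
  exact e ▸ key n (by omega)

lemma exists_isHolonomy {Z : ComplexForm} (hZ : Continuous Z) (γ : Curve) :
    ∃ g, IsHolonomy Z γ g := by
  obtain ⟨u, hu, hu0⟩ := hasSol_velMat hZ γ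
  exact ⟨u 1, isHolonomy_iff.mpr ⟨u, hu, hu0, rfl⟩⟩

/-- Change of parameter in the parallel transport equation. -/
lemma IsSolOn.comp_reparam {Z : ComplexForm} {γ γ' : Curve} {u : ℝ → Mat}
    (hu : IsSolOn (velMat Z γ) 0 1 u) {a b : ℝ} {σ : ℝ → ℝ} (hc : ContinuousOn σ (Set.Icc a b))
    (hm : Set.MapsTo σ (Set.Icc a b) (Set.Icc 0 1)) (hmo : Set.MapsTo σ (Set.Ioo a b) (Set.Ioo 0 1))
    (hinj : Set.InjOn σ (Set.Ioo a b)) {R : Set ℝ} (hR : R.Finite)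
    (hd : ∀ t ∈ Set.Ioo a b \ R, DifferentiableAt ℝ σ t)
    (h : ∀ t ∈ Set.Ioo a b, γ'.toFun t = γ.toFun (σ t)) :
    IsSolOn (velMat Z γ') a b (u ∘ σ) := by
  obtain ⟨huc, P, hP, hud⟩ := hu
  obtain ⟨Q, hQ, hγ⟩ := γ.exists_finite_differentiableAt
  -- The chain rule can fail where `σ` is not differentiable or where `σ` meets an exceptional time
  -- of the solution or of the curve; injectivity of `σ` keeps these preimages finite.
  refine ⟨huc.comp hc hm, R ∪ (Set.Ioo a b ∩ σ ⁻¹' (P ∪ Q)), hR.union ?_, ?_⟩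
  · exact Set.Finite.of_finite_image ((hP.union hQ).subset (by
      rintro _ ⟨x, hx, rfl⟩; exact hx.2)) (hinj.mono Set.inter_subset_left)
  · rintro t ⟨ht, hn⟩
    simp only [Set.mem_union, not_or, Set.mem_inter_iff, not_and, Set.mem_preimage] at hn
    have hσ := (hd t ⟨ht, hn.1⟩).hasDerivAt
    have hn2 := hn.2 ht
    have hg := (hγ _ ⟨hmo ht, hn2.2⟩).hasDerivAt
    have hg' : HasDerivAt γ'.toFun (deriv σ t • deriv γ.toFun (σ t)) t := by
      refine (hg.scomp t hσ).congr_of_eventuallyEq ?_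
      filter_upwards [Ioo_mem_nhds ht.1 ht.2] with x hx
      exact h x hx
    have h3 := (hud _ ⟨hmo ht, hn2.1⟩).scomp t hσ
    refine h3.congr_deriv ?_
    rw [velMat, velMat, hg'.deriv, formMat_smul, h t ht, Function.comp_apply]
    exact (Matrix.smul_mul _ _ _).symm

/-- The generalized connection of the holonomies of a continuous one-form. -/
def holConn (S : Set Mat) {Z : ComplexForm} (hZ : Continuous Z)
    (hS : ∀ γ g, IsHolonomy Z γ g → g ∈ S) : GenConn S where
  toFun γ := (exists_isHolonomy hZ γ).choose
  mem γ := hS γ _ (exists_isHolonomy hZ γ).choose_spec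
  reparam := by
    intro γ γ' τ hc hmono h0 h1 ⟨P, hP, hd⟩ h
    refine (exists_isHolonomy hZ γ').choose_spec.unique ?_
    obtain ⟨u, hu, hu0, hu1⟩ := isHolonomy_iff.mp (exists_isHolonomy hZ γ).choose_spec
    have l0 : (0 : ℝ) ∈ Set.Icc (0 : ℝ) 1 := by simp
    have l1 : (1 : ℝ) ∈ Set.Icc (0 : ℝ) 1 := by simp
    refine isHolonomy_iff.mpr ⟨u ∘ τ, hu.comp_reparam hc ?_ ?_
      (hmono.injOn.mono Set.Ioo_subset_Icc_self) hP hd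
      fun t ht => h t (Set.Ioo_subset_Icc_self ht), by simp [h0, hu0], by simp [h1, hu1]⟩
    · intro t ht
      exact ⟨h0 ▸ hmono.monotoneOn l0 ht ht.1, h1 ▸ hmono.monotoneOn ht l1 ht.2⟩
    · intro t ht
      have ht' := Set.Ioo_subset_Icc_self ht
      exact ⟨h0 ▸ hmono l0 ht' ht.1, h1 ▸ hmono ht' l1 ht.2⟩
  comp := by
    intro γ₁ γ₂ γ h1 h2
    refine (exists_isHolonomy hZ γ).choose_spec.unique ?_
    obtain ⟨u, hu, hu0, hu1⟩ := isHolonomy_iff.mp (exists_isHolonomy hZ γ₁).choose_spec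
    obtain ⟨v, hv, hv0, hv1⟩ := isHolonomy_iff.mp (exists_isHolonomy hZ γ₂).choose_spec
    have k1 : IsSolOn (velMat Z γ) 0 (1 / 2) (u ∘ fun t => 2 * t) :=
      hu.comp_reparam (by fun_prop) (fun t ht => ⟨by linarith [ht.1], by linarith [ht.2]⟩)
        (fun t ht => ⟨by linarith [ht.1], by linarith [ht.2]⟩)
        (fun x _ y _ hxy => by simpa using hxy) Set.finite_empty (fun t _ => by fun_prop)
        fun t ht => h1 t (Set.Ioo_subset_Icc_self ht)
    have k2 : IsSolOn (velMat Z γ) (1 / 2) 1 (v ∘ fun t => 2 * t - 1) :=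
      hv.comp_reparam (by fun_prop) (fun t ht => ⟨by linarith [ht.1], by linarith [ht.2]⟩)
        (fun t ht => ⟨by linarith [ht.1], by linarith [ht.2]⟩)
        (fun x _ y _ hxy => by simpa using hxy) Set.finite_empty (fun t _ => by fun_prop)
        fun t ht => h2 t (Set.Ioo_subset_Icc_self ht)
    refine isHolonomy_iff.mpr ⟨_, k1.glue (by norm_num) (by norm_num) k2 ?_, ?_, ?_⟩
    · norm_num [hv0]
    · norm_num [hu0]
    · norm_num [hv1, hu1]
  inv := by
    intro γ γ' h
    obtain ⟨u, hu, hu0, hu1⟩ := isHolonomy_iff.mp (exists_isHolonomy hZ γ).choose_spec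
    obtain ⟨v, hv, hv0, hv1⟩ := isHolonomy_iff.mp (exists_isHolonomy hZ γ').choose_spec
    have k1 : IsSolOn (velMat Z γ') 0 1 (u ∘ fun t => 1 - t) :=
      hu.comp_reparam (by fun_prop) (fun t ht => ⟨by linarith [ht.2], by linarith [ht.1]⟩)
        (fun t ht => ⟨by linarith [ht.2], by linarith [ht.1]⟩)
        (fun x _ y _ hxy => by simpa using hxy) Set.finite_empty (fun t _ => by fun_prop)
        fun t ht => h t (Set.Ioo_subset_Icc_self ht)
    -- The reversed solution starts at `u 1` and ends at the identity, so comparing the constant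
    -- `adj(u(1 - t)) v(t)` at both ends gives `v 1 = adj (u 1)`.
    have k := IsSolOn.adjugate_mul (fun t => trace_formMat Z _ _) k1 hv (t := 1) (by simp)
    simp only [Function.comp_apply, sub_self, sub_zero, hu0, hv0, Matrix.adjugate_one, one_mul,
      mul_one] at k
    rw [← hv1, ← hu1, k, Matrix.adjugate_mul,
      hu.det_eq_one (fun t => trace_formMat Z _ _) hu0 (by simp), one_smul]

lemma isHolonomy_holonomies {S : Set Mat} (h1 : (1 : Mat) ∈ S) {Z : ComplexForm}
    (hZ : Continuous Z) (hS : ∀ γ g, IsHolonomy Z γ g → g ∈ S) (γ : Curve) :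
    IsHolonomy Z γ ((holonomies h1 Z).toFun γ) := by
  have h : ∃ A : GenConn S, ∀ γ, IsHolonomy Z γ (A.toFun γ) :=
    ⟨holConn S hZ hS, fun γ => (exists_isHolonomy hZ γ).choose_spec⟩
  rw [holonomies, dif_pos h]
  exact h.choose_spec γ

/-! ### The symmetric connections -/

/-- Translations make `A` constant. The half turn about the axis `v` fixes `v`, hence fixes `A v`,
so `A v` lies on the axis. A linear map for which every vector is an eigenvector is a scalar. -/
lemma eq_smul_of_isEuclideanInvariant {A : RealForm} (h : IsEuclideanInvariant A) :
    ∃ a : ℝ, ∀ x v, A x v = a • v := by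
  have h0 : ∀ x v, A x v = A 0 v := fun x v => by
    simpa using h (LinearIsometryEquiv.refl ℝ Space)
      (show LinearMap.det (LinearMap.id : Space →ₗ[ℝ] Space) = 1 from LinearMap.det_id) x 0 v
  have hind : ∀ v,
      ¬ LinearIndependent ℝ ![v, ((A 0 : Space →L[ℝ] Space) : Space →ₗ[ℝ] Space) v] := by
    intro v hv
    have hv0 : v ≠ 0 := hv.ne_zero 0
    have hdet : LinearMap.det ((ℝ ∙ v).reflection.toLinearEquiv : Space →ₗ[ℝ] Space) = 1 := by
      refine ((ℝ ∙ v).det_reflection).trans ?_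
      have := (ℝ ∙ v).finrank_add_finrank_orthogonal
      rw [finrank_span_singleton hv0, finrank_euclideanSpace_fin] at this
      have e : Module.finrank ℝ (ℝ ∙ v)ᗮ = 2 := by omega
      rw [e]; norm_num
    have hr := h _ hdet 0 0 v
    rw [Submodule.reflection_mem_subspace_eq_self (Submodule.mem_span_singleton_self v), map_zero,
      add_zero] at hr
    obtain ⟨c, hc⟩ := Submodule.mem_span_singleton.mp
      ((Submodule.reflection_eq_self_iff _).mp hr.symm)
    have := (LinearIndependent.pair_iff.mp hv) c (-1) (by simp [hc])
    simp at this
  obtain ⟨a, ha⟩ := LinearMap.exists_eq_smul_id_of_forall_notLinearIndependent hind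
  exact ⟨a, fun x v => by rw [h0]; exact congrArg (fun f : Space →ₗ[ℝ] Space => f v) ha⟩

lemma entire_eq_of_eq_on_real {f g : ℂ → ℂ} (hf : Differentiable ℂ f) (hg : Differentiable ℂ g)
    (h : ∀ c : ℝ, f c = g c) : f = g := by
  refine AnalyticOnNhd.eq_of_frequently_eq (z₀ := 0)
    (fun z _ => hf.analyticAt z) (fun z _ => hg.analyticAt z) ?_
  have ht : Filter.Tendsto (fun c : ℝ => (c : ℂ)) (nhdsWithin 0 {0}ᶜ) (nhdsWithin 0 {0}ᶜ) := by
    refine tendsto_nhdsWithin_iff.mpr ⟨?_, ?_⟩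
    · exact (Complex.continuous_ofReal.tendsto' 0 0 (by simp)).mono_left nhdsWithin_le_nhds
    · filter_upwards [self_mem_nhdsWithin] with c hc
      simpa using hc
  exact ht.frequently (Filter.Eventually.of_forall h).frequently

lemma scaledForm_apply {A₀ : SmoothConn} {a : ℝ} (ha : ∀ x v, A₀.1 x v = a • v) (z : ℂ)
    (x v : Space) (i : Fin 3) : scaledForm A₀ z x v i = z * a * v i := by
  simp [scaledForm, toComplexForm, ha, mul_assoc]

/-- A holomorphic map into the connections that restricts to `c ↦ c A₀` on the real line is
`z ↦ z A₀`. -/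
lemma eq_scaledForm {A₀ : SmoothConn} {s : ℂ → SmoothConnC} (hs : ∀ c : ℝ, (s c).1 = scaledForm A₀ c)
    (hshol : IsHolomorphicMap s) (z : ℂ) : (s z).1 = scaledForm A₀ z := by
  funext x
  ext v i
  have h : (fun z => (s z).1 x v i) = fun z => scaledForm A₀ z x v i :=
    entire_eq_of_eq_on_real (hshol x v i)
      (by simp only [scaledForm, smul_apply, Pi.smul_apply, smul_eq_mul]
          fun_prop) (fun c => by simp only [hs])
  exact congrFun h z

/-! ### Holonomies along straight edges -/

/-- The matrix of a vector in the basis `τ_i`. -/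
def dirMat (v : Space) : Mat := ∑ i, (v i : ℂ) • tau i

lemma dirMat_eq (v : Space) : dirMat v =
    !![-Complex.I / 2 * v 2, -Complex.I / 2 * v 0 - 1 / 2 * v 1;
      -Complex.I / 2 * v 0 + 1 / 2 * v 1, Complex.I / 2 * v 2] := by
  ext i j
  fin_cases i <;> fin_cases j <;> simp [dirMat, tau, Fin.sum_univ_three] <;> ring

/-- The Clifford relation of the `τ_i`. It makes the exponential of a multiple of `dirMat v`
collapse to the two terms of `rotMat`. -/
lemma dirMat_mul_self (v : Space) : dirMat v * dirMat v = (-(‖v‖ : ℂ) ^ 2 / 4) • (1 : Mat) := by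
  have h : (‖v‖ : ℂ) ^ 2 = (v 0 : ℂ) ^ 2 + (v 1 : ℂ) ^ 2 + (v 2 : ℂ) ^ 2 := by
    have := EuclideanSpace.real_norm_sq_eq v
    rw [Fin.sum_univ_three] at this
    exact_mod_cast this
  rw [dirMat_eq, h]
  ext i j
  fin_cases i <;> fin_cases j <;> simp [Matrix.mul_apply, Fin.sum_univ_two] <;> ring_nf <;>
    simp only [Complex.I_sq] <;> ring

/-- The complex rotation about the axis `v` as a function of `ζ = exp(iθ/2)`, `θ` the angle. -/
def rotMat (v : Space) (ζ : ℂ) : Mat :=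
  ((ζ + ζ⁻¹) / 2) • (1 : Mat) + ((ζ - ζ⁻¹) / (Complex.I * ‖v‖)) • dirMat v

/-- The displacement of a straight edge. -/
def StraightEdge.dir (e : StraightEdge) : Space := e.tgt - e.src

lemma StraightEdge.dir_ne (e : StraightEdge) : e.dir ≠ 0 := sub_ne_zero.mpr e.ne.symm

lemma StraightEdge.deriv_toCurve (e : StraightEdge) (t : ℝ) : deriv e.toCurve.toFun t = e.dir := by
  have hd : HasDerivAt (fun t : ℝ => e.src + t • (e.tgt - e.src)) (e.tgt - e.src) t := by
    simpa using ((hasDerivAt_id t).smul_const (e.tgt - e.src)).const_add e.src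
  exact hd.deriv

/-- The exponent of the holonomy along a straight edge. -/
def edgePhase (a : ℝ) (e : StraightEdge) (z : ℂ) : ℂ :=
  Complex.exp (Complex.I * (a * ‖e.dir‖ : ℝ) * z / 2)

/-- Along a straight edge the coefficient of the transport equation is the constant `z a • dirMat
e.dir`. Its exponential is the curve `rotMat e.dir (exp (κ t))`, checked by differentiation and the
Clifford relation. -/
lemma isHolonomy_straightEdge {A₀ : SmoothConn} {a : ℝ} (ha : ∀ x v, A₀.1 x v = a • v) (z : ℂ)
    (e : StraightEdge) :
    IsHolonomy (scaledForm A₀ z) e.toCurve (rotMat e.dir (edgePhase a e z)) := by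
  set n : ℂ := (‖e.dir‖ : ℂ) with hn
  have hn0 : n ≠ 0 := by simpa [hn] using e.dir_ne
  set κ : ℂ := Complex.I * (a * ‖e.dir‖ : ℝ) * z / 2 with hκ
  have hd : ∀ t : ℝ, HasDerivAt (fun t : ℝ => rotMat e.dir (Complex.exp (κ * t)))
      (velMat (scaledForm A₀ z) e.toCurve t * rotMat e.dir (Complex.exp (κ * t))) t := by
    intro t
    have h1 : HasDerivAt (fun t : ℝ => Complex.exp (κ * t)) (κ * Complex.exp (κ * t)) t := by
      have := ((Complex.ofRealCLM.hasDerivAt (x := t)).const_mul κ).cexp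
      simpa [mul_comm] using this
    have h2 : HasDerivAt (fun t : ℝ => (Complex.exp (κ * t))⁻¹) (-κ * (Complex.exp (κ * t))⁻¹) t := by
      refine (h1.inv (Complex.exp_ne_zero _)).congr_deriv ?_
      field_simp [Complex.exp_ne_zero]
    set ζ := Complex.exp (κ * t) with hζ
    have hvel : velMat (scaledForm A₀ z) e.toCurve t = (z * a) • dirMat e.dir := by
      simp only [velMat, formMat, e.deriv_toCurve, scaledForm_apply ha, dirMat, Finset.smul_sum,
        smul_smul]
    have h3 : HasDerivAt (fun t : ℝ => rotMat e.dir (Complex.exp (κ * t)))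
        (((κ * ζ + -κ * ζ⁻¹) / 2) • (1 : Mat) +
          ((κ * ζ - -κ * ζ⁻¹) / (Complex.I * n)) • dirMat e.dir) t := by
      rw [hasDerivAt_mat_iff]
      intro i j
      exact (((h1.add h2).div_const 2).mul_const ((1 : Mat) i j)).add
        (((h1.sub h2).div_const (Complex.I * n)).mul_const (dirMat e.dir i j))
    refine h3.congr_deriv ?_
    rw [hvel, rotMat, Matrix.mul_add, Matrix.smul_mul, Matrix.smul_mul, Matrix.mul_smul,
      Matrix.mul_smul, dirMat_mul_self, mul_one, smul_smul, smul_smul, smul_smul, add_comm]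
    have hκ' : κ = Complex.I * a * n * z / 2 := by rw [hκ, hn]; push_cast; ring
    congr 2
    · rw [hκ']
      field_simp
      ring
    · rw [hκ', ← hn]
      generalize ζ⁻¹ = ξ
      field_simp
      linear_combination (4 * z * a * (ζ - ξ)) * Complex.I_sq
  refine isHolonomy_iff.mpr ⟨fun t => rotMat e.dir (Complex.exp (κ * t)),
    ⟨fun t _ => (hd t).continuousAt.continuousWithinAt, ∅, Set.finite_empty, fun t _ => hd t⟩, ?_, ?_⟩
  · simp [rotMat]
  · simp [edgePhase, hκ]

lemma continuous_scaledForm {A₀ : SmoothConn} {a : ℝ} (ha : ∀ x v, A₀.1 x v = a • v) (z : ℂ) :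
    Continuous (scaledForm A₀ z) := by
  have h : scaledForm A₀ z = fun _ => scaledForm A₀ z 0 := by
    funext x; ext v i; simp only [scaledForm_apply ha]
  rw [h]
  exact continuous_const

lemma symmConn_straightEdge {A₀ : SmoothConn} {a : ℝ} (ha : ∀ x v, A₀.1 x v = a • v) (c : ℝ)
    (e : StraightEdge) :
    (symmConn A₀ c).toFun e.toCurve = rotMat e.dir (edgePhase a e c) := by
  refine (isHolonomy_holonomies one_mem_SU2 (continuous_scaledForm ha c) (fun γ g hg => ?_) _).unique
    (isHolonomy_straightEdge ha c e)
  refine hg.mem_SU2 fun x v i => ?_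
  rw [scaledForm_apply ha]
  norm_cast

lemma viaHolonomies_straightEdge {A₀ : SmoothConn} {a : ℝ} (ha : ∀ x v, A₀.1 x v = a • v)
    {s : ℂ → SmoothConnC} (hs : ∀ z, (s z).1 = scaledForm A₀ z) (z : ℂ) (e : StraightEdge) :
    (viaHolonomies s z).toFun e.toCurve = rotMat e.dir (edgePhase a e z) := by
  have h := isHolonomy_holonomies one_mem_SL2 (continuous_scaledForm ha z)
    (fun γ g hg => hg.mem_SL2) e.toCurve
  rw [viaHolonomies, hs]
  exact h.unique (isHolonomy_straightEdge ha z e)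

lemma rotMat_mem_SL2 {v : Space} (hv : v ≠ 0) {ζ : ℂ} (hζ : ζ ≠ 0) : rotMat v ζ ∈ SL2 := by
  have hn0 : (‖v‖ : ℂ) ≠ 0 := by simpa using hv
  have h : (‖v‖ : ℂ) ^ 2 = (v 0 : ℂ) ^ 2 + (v 1 : ℂ) ^ 2 + (v 2 : ℂ) ^ 2 := by
    have := EuclideanSpace.real_norm_sq_eq v
    rw [Fin.sum_univ_three] at this
    exact_mod_cast this
  have hd : (dirMat v).det = (‖v‖ : ℂ) ^ 2 / 4 := by
    rw [dirMat_eq, Matrix.det_fin_two_of, h]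
    linear_combination (-(v 2 : ℂ) ^ 2 / 4 - (v 0 : ℂ) ^ 2 / 4) * Complex.I_sq
  have key : ∀ x y : ℂ, (x • (1 : Mat) + y • dirMat v).det = x ^ 2 + y ^ 2 * (dirMat v).det := by
    intro x y
    rw [dirMat_eq, Matrix.det_fin_two_of, Matrix.det_fin_two]
    simp
    ring
  change (rotMat v ζ).det = 1
  rw [rotMat, key, hd]
  field_simp
  rw [Complex.I_sq]
  ring

/-! ### The heat flow of a non-negative self-adjoint operator -/

section HeatFlow

variable {H : Type*} [NormedAddCommGroup H] [InnerProductSpace ℂ H]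

/-- The derivative of `‖u‖²` is `-2 Re ⟨u, T u⟩ ≤ 0`, so the norm cannot grow from zero. -/
lemma IsExpNeg.eq_zero_of_left {T : H →ₗ.[ℂ] H}
    (hpos : ∀ x : T.domain, 0 ≤ (inner ℂ (x : H) (T x)).re) {y : H} (h : IsExpNeg T 0 y) :
    y = 0 := by
  obtain ⟨u, hc, h0, h1, hd⟩ := h
  have hcf : ContinuousOn (fun t => (inner ℂ (u t) (u t)).re) (Set.Ici 0) :=
    Complex.continuous_re.comp_continuousOn (hc.inner hc)
  have hder : ∀ t : ℝ, ∀ ht : 0 < t, HasDerivAt (fun t => (inner ℂ (u t) (u t)).re)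
      (-(2 * (inner ℂ (u t) (T ⟨u t, (hd t ht).choose⟩)).re)) t := by
    intro t ht
    obtain ⟨m, hu⟩ := hd t ht
    refine (Complex.reCLM.hasFDerivAt.comp_hasDerivAt t (hu.inner ℂ hu)).congr_deriv ?_
    have e := congrArg Complex.re (inner_conj_symm (𝕜 := ℂ) (T ⟨u t, m⟩) (u t))
    rw [Complex.conj_re] at e
    rw [map_add, inner_neg_right, inner_neg_left, map_neg, map_neg, Complex.reCLM_apply,
      Complex.reCLM_apply, ← e]
    ring
  have hanti : AntitoneOn (fun t => (inner ℂ (u t) (u t)).re) (Set.Ici 0) := by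
    refine antitoneOn_of_deriv_nonpos (convex_Ici 0) hcf ?_ ?_
    · intro t ht
      rw [interior_Ici] at ht
      exact (hder t ht).differentiableAt.differentiableWithinAt
    · intro t ht
      rw [interior_Ici] at ht
      rw [(hder t ht).deriv]
      have := hpos ⟨u t, (hd t ht).choose⟩
      simp only at this
      linarith
  have hle := hanti (Set.mem_Ici.mpr le_rfl) (Set.mem_Ici.mpr zero_le_one) zero_le_one
  simp only [h0, h1, inner_zero_left, Complex.zero_re] at hle
  have : ‖y‖ ^ 2 ≤ 0 := by
    rw [← inner_self_eq_norm_sq (𝕜 := ℂ)]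
    exact hle
  have h2 : ‖y‖ = 0 := by nlinarith [norm_nonneg y]
  exact norm_eq_zero.mp h2

/-- For symmetric `T` the product `⟨u(t), u(b - t)⟩` is constant in `t`. If `u(b) = 0` it vanishes,
and `t = b/2` gives `u(b/2) = 0`. Halving repeatedly from `b = 1` and using continuity at `0` gives
`x = 0`; no spectral theorem is needed. -/
lemma IsExpNeg.eq_zero_of_right {T : H →ₗ.[ℂ] H} (hT : T.IsFormalAdjoint T) {x : H}
    (h : IsExpNeg T x 0) : x = 0 := by
  obtain ⟨u, hc, h0, h1, hd⟩ := h
  have hhalf : ∀ b : ℝ, 0 < b → u b = 0 → u (b / 2) = 0 := by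
    intro b hb hub
    have hcc : ContinuousOn (fun t => inner ℂ (u t) (u (b - t))) (Set.Icc 0 b) := by
      refine (hc.mono Set.Icc_subset_Ici_self).inner
        (hc.comp (f := fun t => b - t)
          (by fun_prop) fun t ht => ?_)
      exact sub_nonneg.mpr ht.2
    have hmem : b / 2 ∈ Set.Icc 0 b := ⟨by linarith, by linarith⟩
    have := eq_of_hasDerivAt_zero_off_finite hcc Set.finite_empty (fun t ht => ?_) hmem
    · simp only [sub_half, sub_zero, hub, inner_zero_right] at this
      exact inner_self_eq_zero.mp this
    · obtain ⟨m, hu⟩ := hd t ht.1.1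
      obtain ⟨m', hu'⟩ := hd (b - t) (sub_pos.mpr ht.1.2)
      have hu2 := hu'.scomp t ((hasDerivAt_id t).const_sub b)
      refine (hu.inner ℂ hu2).congr_deriv ?_
      have := hT ⟨u t, m⟩ ⟨u (b - t), m'⟩
      simp only at this
      simp [inner_neg_left, this]
  have hn : ∀ n : ℕ, u ((1 / 2) ^ n) = 0 := by
    intro n
    induction n with
    | zero => simpa using h1
    | succ n ih =>
      rw [pow_succ, mul_one_div]
      exact hhalf _ (by positivity) ih
  have hlim : Filter.Tendsto (fun n : ℕ => u ((1 / 2) ^ n)) Filter.atTop (nhds (u 0)) := by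
    refine (hc 0 (Set.mem_Ici.mpr le_rfl)).tendsto.comp (tendsto_nhdsWithin_iff.mpr ⟨?_, ?_⟩)
    · exact tendsto_pow_atTop_nhds_zero_of_lt_one (by norm_num) (by norm_num)
    · exact Filter.Eventually.of_forall fun n => Set.mem_Ici.mpr (by positivity)
  simp only [hn] at hlim
  rw [← h0]
  exact tendsto_nhds_unique hlim tendsto_const_nhds

lemma isFormalAdjoint_self [CompleteSpace H] {T : H →ₗ.[ℂ] H} (hT : IsSelfAdjoint T) :
    T.IsFormalAdjoint T := by
  have h := LinearPMap.adjoint_isFormalAdjoint hT.dense_domain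
  rwa [LinearPMap.isSelfAdjoint_def.mp hT] at h

end HeatFlow

/-! ### Cylindrical functions and the Ashtekar–Lewandowski measure -/

lemma continuous_genConn_apply {S : Set Mat} (γ : Curve) :
    Continuous fun A : GenConn S => A.toFun γ :=
  (continuous_apply γ).comp continuous_induced_dom

lemma continuous_of_mem_cyl {Φ : GenConn SU2 → ℂ} {n : ℕ} {e : Fin n → StraightEdge}
    {f : (Fin n → Mat) → ℂ} (hf : ContinuousOn f {g | ∀ i, g i ∈ SU2})
    (hΦ : ∀ A : GenConn SU2, Φ A = f fun i => A.toFun (e i).toCurve) : Continuous Φ := by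
  rw [funext hΦ]
  exact hf.comp_continuous (continuous_pi fun i => continuous_genConn_apply _)
    fun A i => A.mem _

lemma Cyl.continuous {Φ : GenConn SU2 → ℂ} (hΦ : Φ ∈ Cyl) : Continuous Φ := by
  obtain ⟨n, e, f, hf, h⟩ := hΦ
  exact continuous_of_mem_cyl hf.continuousOn h

lemma HolCyl.continuous_complexify {W : GenConn SL2 → ℂ} (hW : W ∈ HolCyl) :
    Continuous fun A : GenConn SU2 => W A.complexify := by
  obtain ⟨n, e, f, hf, h⟩ := hW
  exact continuous_of_mem_cyl (hf.continuousOn.mono fun g hg i => SU2_subset_SL2 (hg i))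
    fun A => h A.complexify

/-- The holonomies of generalized connections along the edges of a graph are dense in `SU(2)ⁿ`. -/
lemma dense_holonomies {μ : MeasureTheory.Measure (GenConn SU2)} (hμ : IsAshtekarLewandowski μ)
    {n : ℕ} {γ : Fin n → Curve} (hγ : IsGraph γ) {g : Fin n → Mat} (hg : ∀ i, g i ∈ SU2) :
    g ∈ closure (Set.range fun (A : GenConn SU2) i => A.toFun (γ i)) := by
  have := hμ.prob
  have := hμ.faithful
  refine Metric.mem_closure_iff.mpr ?_
  by_contra! hcon
  obtain ⟨r, hr, hcon⟩ := hcon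
  -- A bump at `g` that vanishes on all holonomies. Translation by `g` preserves its integral, so
  -- the translated bump has integral zero, and by faithfulness and continuity it vanishes
  -- identically; yet at the trivial connection it equals `r`.
  let b : (Fin n → Mat) → ℝ := fun x => max 0 (r - dist g x)
  have hb : Continuous b := by fun_prop
  have hb0 : ∀ x, 0 ≤ b x := fun x => le_max_left _ _
  have hev' : Continuous fun (A : GenConn SU2) i => g i * A.toFun (γ i) :=
    continuous_pi fun i => continuous_const.matrix_mul (continuous_genConn_apply _)
  have hzero : ∀ A : GenConn SU2, b (fun i => A.toFun (γ i)) = 0 := fun A =>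
    max_eq_left (by linarith [hcon _ ⟨A, rfl⟩])
  have hinv := hμ.haar n γ hγ g hg (fun x => (b x : ℂ)) (Complex.continuous_ofReal.comp hb)
  simp only [hzero, Complex.ofReal_zero, MeasureTheory.integral_zero] at hinv
  have hinv' : ∫ A : GenConn SU2, b (fun i => g i * A.toFun (γ i)) ∂μ = 0 :=
    Complex.ofReal_eq_zero.mp (integral_complex_ofReal.symm.trans hinv)
  have h_int : MeasureTheory.Integrable
      (fun A : GenConn SU2 => b (fun i => g i * A.toFun (γ i))) μ := by
    refine MeasureTheory.Integrable.of_bound (C := r)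
      (hb.comp hev').measurable.aestronglyMeasurable (Filter.Eventually.of_forall fun A => ?_)
    rw [Real.norm_of_nonneg (hb0 _)]
    exact max_le hr.le (by linarith [dist_nonneg (x := g) (y := fun i => g i * A.toFun (γ i))])
  rw [MeasureTheory.integral_eq_zero_iff_of_nonneg (fun A => hb0 _) h_int]
    at hinv'
  have hall := ((hb.comp hev').ae_eq_iff_eq μ continuous_const).mp hinv'
  have := congrFun hall (GenConn.trivial one_mem_SU2)
  simp only [GenConn.trivial, mul_one, b, dist_self, sub_zero, Function.comp_apply,
    max_eq_right hr.le] at this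
  exact (ne_of_gt hr) this

/-! ### Uniqueness of Bohr coefficients -/

/-- The winding line in the torus with frequencies `m_j / 2`. -/
def torusLine {n : ℕ} (m : Fin n → ℝ) (c : ℝ) : UnitAddTorus (Fin n) :=
  fun j => ((m j * c / (4 * Real.pi) : ℝ) : UnitAddCircle)

lemma fourier_torusLine {n : ℕ} (m : Fin n → ℝ) (c : ℝ) (k : ℤ) (j : Fin n) :
    fourier k (torusLine m c j) = Complex.exp (Complex.I * (k * m j) * c / 2) := by
  rw [torusLine, fourier_coe_apply]
  congr 1
  have : (Real.pi : ℂ) ≠ 0 := by exact_mod_cast Real.pi_ne_zero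
  push_cast
  field_simp
  ring

lemma mFourier_torusLine {n : ℕ} (m : Fin n → ℝ) (c : ℝ) (k : Fin n → ℤ) :
    UnitAddTorus.mFourier k (torusLine m c) =
      Complex.exp (Complex.I * ((∑ j, k j * m j : ℝ) : ℂ) * c / 2) := by
  simp only [UnitAddTorus.mFourier, ContinuousMap.coe_mk, fourier_torusLine, ← Complex.exp_sum]
  congr 1
  push_cast
  rw [Finset.mul_sum, Finset.sum_mul, Finset.sum_div]

lemma continuous_torusLine {n : ℕ} (m : Fin n → ℝ) : Continuous (torusLine m) :=
  continuous_pi fun j => (AddCircle.continuous_mk' 1).comp (by fun_prop)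

lemma torusLine_sub {n : ℕ} (m : Fin n → ℝ) (c d : ℝ) :
    torusLine m (c - d) = torusLine m c - torusLine m d := by
  funext j
  simp only [torusLine, Pi.sub_apply, ← AddCircle.coe_sub]
  congr 1
  ring

lemma torusLine_add {n : ℕ} (m : Fin n → ℝ) (c d : ℝ) :
    torusLine m (c + d) = torusLine m c + torusLine m d := by
  funext j
  simp only [torusLine, Pi.add_apply, ← AddCircle.coe_add]
  congr 1
  ring

/-- A character restricted to the line is an exponential in `c`, so its mean against `φ` is a Bohr
coefficient at the opposite frequency; linearity does the rest. -/
lemma tendsto_mean_mul_trig {n : ℕ} {m : Fin n → ℝ} {φ : ℝ → ℂ} (hφc : Continuous φ)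
    (h : ∀ μ, IsBohrCoeff φ μ 0) {p : C(UnitAddTorus (Fin n), ℂ)}
    (hp : p ∈ Submodule.span ℂ (Set.range (UnitAddTorus.mFourier (d := Fin n)))) :
    Filter.Tendsto (fun T : ℝ => ((2 * T : ℝ) : ℂ)⁻¹ * ∫ c in (-T)..T, p (torusLine m c) * φ c)
      Filter.atTop (nhds 0) := by
  have hci : ∀ q : C(UnitAddTorus (Fin n), ℂ), ∀ T : ℝ,
      IntervalIntegrable (fun c => q (torusLine m c) * φ c) MeasureTheory.volume (-T) T :=
    fun q T => (((map_continuous q).comp (continuous_torusLine m)).mul hφc).intervalIntegrable _ _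
  induction hp using Submodule.span_induction with
  | mem p hp =>
    obtain ⟨k, rfl⟩ := hp
    refine (h (-(∑ j, k j * m j))).2.congr fun T => ?_
    congr 2
    funext c
    rw [mFourier_torusLine]
    congr 2
    push_cast
    ring
  | zero => simp
  | add p q _ _ hp hq =>
    have := hp.add hq
    rw [add_zero] at this
    refine this.congr fun T => ?_
    rw [← mul_add, ← intervalIntegral.integral_add (hci p T) (hci q T)]
    simp only [ContinuousMap.add_apply, add_mul]
  | smul a p _ hp =>
    have := hp.const_mul a
    rw [mul_zero] at this
    refine this.congr fun T => ?_
    rw [mul_left_comm, ← intervalIntegral.integral_const_mul]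
    simp only [ContinuousMap.smul_apply, smul_eq_mul, mul_assoc]

/-- With a trigonometric polynomial `p` uniformly close to the conjugate of `g`, write `|φ|² = p φ +
(φ̄ - p) φ`: the first term has mean tending to zero, the second is uniformly small. -/
lemma tendsto_mean_norm_sq {n : ℕ} {m : Fin n → ℝ} {φ : ℝ → ℂ} {g : C(UnitAddTorus (Fin n), ℂ)}
    (hφ : ∀ c, φ c = g (torusLine m c)) (h : ∀ μ, IsBohrCoeff φ μ 0) :
    Filter.Tendsto (fun T : ℝ => (2 * T)⁻¹ * ∫ c in (-T)..T, ‖φ c‖ ^ 2) Filter.atTop (nhds 0) := by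
  have hφc : Continuous φ := by
    rw [funext hφ]; exact (map_continuous g).comp (continuous_torusLine m)
  rw [Metric.tendsto_nhds]
  intro ε hε
  obtain ⟨p, hp, hpg⟩ : ∃ p ∈ Submodule.span ℂ (Set.range (UnitAddTorus.mFourier (d := Fin n))),
      dist (star g) p < ε / (2 * (‖g‖ + 1)) := by
    have hmem : star g ∈ (Submodule.span ℂ
        (Set.range (UnitAddTorus.mFourier (d := Fin n)))).topologicalClosure := by
      rw [UnitAddTorus.span_mFourier_closure_eq_top]; trivial
    exact Metric.mem_closure_iff.mp hmem _ (by positivity)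
  have hlim := (Metric.tendsto_nhds.mp (tendsto_mean_mul_trig (m := m) hφc h hp)) (ε / 2)
    (by positivity)
  filter_upwards [hlim, Filter.eventually_gt_atTop 0] with T hT hT0
  rw [dist_zero_right] at hT
  have hpc : Continuous fun c => p (torusLine m c) :=
    (map_continuous p).comp (continuous_torusLine m)
  have hnn : 0 ≤ (2 * T)⁻¹ * ∫ c in (-T)..T, ‖φ c‖ ^ 2 :=
    mul_nonneg (by positivity)
      (intervalIntegral.integral_nonneg (by linarith) fun c _ => by positivity)
  rw [dist_zero_right, Real.norm_of_nonneg hnn]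
  have hb : ∀ c, ‖(star (φ c) - p (torusLine m c)) * φ c‖ ≤ ε / 2 := by
    intro c
    have h1 : ‖star (φ c) - p (torusLine m c)‖ ≤ ε / (2 * (‖g‖ + 1)) := by
      rw [hφ c]
      have := (star g - p).norm_coe_le_norm (torusLine m c)
      rw [dist_eq_norm] at hpg
      exact this.trans hpg.le
    have h2 : ‖φ c‖ ≤ ‖g‖ + 1 := by
      rw [hφ c]
      linarith [g.norm_coe_le_norm (torusLine m c)]
    rw [norm_mul]
    calc _ ≤ ε / (2 * (‖g‖ + 1)) * (‖g‖ + 1) :=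
          mul_le_mul h1 h2 (norm_nonneg _) (by positivity)
      _ = ε / 2 := by
          have : ‖g‖ + 1 ≠ 0 := by positivity
          field_simp
  have hsplit : (((2 * T)⁻¹ * ∫ c in (-T)..T, ‖φ c‖ ^ 2 : ℝ) : ℂ) =
      ((2 * T : ℝ) : ℂ)⁻¹ * (∫ c in (-T)..T, p (torusLine m c) * φ c) +
      ((2 * T : ℝ) : ℂ)⁻¹ * ∫ c in (-T)..T, (star (φ c) - p (torusLine m c)) * φ c := by
    have hi₁ : IntervalIntegrable (fun c => p (torusLine m c) * φ c) MeasureTheory.volume (-T) T :=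
      (hpc.mul hφc).intervalIntegrable _ _
    have hi₂ : IntervalIntegrable (fun c => (star (φ c) - p (torusLine m c)) * φ c)
        MeasureTheory.volume (-T) T := ((hφc.star.sub hpc).mul hφc).intervalIntegrable _ _
    rw [← mul_add, ← intervalIntegral.integral_add hi₁ hi₂, Complex.ofReal_mul,
      Complex.ofReal_inv, ← intervalIntegral.integral_ofReal]
    congr 2
    funext c
    rw [← add_mul, add_sub_cancel]
    have := Complex.conj_mul' (φ c)
    push_cast
    exact this.symm
  have hest : ‖((2 * T : ℝ) : ℂ)⁻¹ * ∫ c in (-T)..T, (star (φ c) - p (torusLine m c)) * φ c‖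
      ≤ ε / 2 := by
    have := intervalIntegral.norm_integral_le_of_norm_le_const (a := -T) (b := T)
      (f := fun c => (star (φ c) - p (torusLine m c)) * φ c) (fun c _ => hb c)
    have habs : |T - -T| = 2 * T := by rw [abs_of_pos (by linarith)]; ring
    rw [habs] at this
    rw [norm_mul, norm_inv, Complex.norm_real, Real.norm_of_nonneg (by positivity),
      inv_mul_le_iff₀ (by positivity)]
    linarith
  have hfin : ‖(((2 * T)⁻¹ * ∫ c in (-T)..T, ‖φ c‖ ^ 2 : ℝ) : ℂ)‖ < ε := by
    rw [hsplit]
    linarith [norm_add_le (((2 * T : ℝ) : ℂ)⁻¹ * (∫ c in (-T)..T, p (torusLine m c) * φ c))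
      (((2 * T : ℝ) : ℂ)⁻¹ * ∫ c in (-T)..T, (star (φ c) - p (torusLine m c)) * φ c)]
  rwa [Complex.norm_real, Real.norm_of_nonneg hnn] at hfin

/-- The shifted interval lies in `[-(T + |d|), T + |d|]`, and the ratio of the lengths tends to one.
-/
lemma tendsto_mean_translate {f : ℝ → ℝ} (hf : Continuous f) (hf0 : ∀ c, 0 ≤ f c)
    (h : Filter.Tendsto (fun T : ℝ => (2 * T)⁻¹ * ∫ c in (-T)..T, f c) Filter.atTop (nhds 0))
    (d : ℝ) :
    Filter.Tendsto (fun T : ℝ => (2 * T)⁻¹ * ∫ c in (-T)..T, f (c + d)) Filter.atTop (nhds 0) := by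
  have h1 : Filter.Tendsto (fun T : ℝ => T + |d|) Filter.atTop Filter.atTop :=
    Filter.tendsto_atTop_add_const_right _ _ Filter.tendsto_id
  have h2 : Filter.Tendsto (fun T : ℝ => 1 + |d| * T⁻¹) Filter.atTop (nhds (1 + |d| * 0)) :=
    (tendsto_inv_atTop_zero.const_mul _).const_add _
  have h3 := h2.mul (h.comp h1)
  rw [mul_zero] at h3
  refine squeeze_zero' ?_ ?_ h3
  · filter_upwards [Filter.eventually_gt_atTop 0] with T hT
    exact mul_nonneg (by positivity)
      (intervalIntegral.integral_nonneg (by linarith) fun c _ => hf0 _)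
  · filter_upwards [Filter.eventually_gt_atTop 0] with T hT
    rw [intervalIntegral.integral_comp_add_right]
    have hle : ∫ c in (-T + d)..(T + d), f c ≤ ∫ c in (-(T + |d|))..(T + |d|), f c := by
      refine intervalIntegral.integral_mono_interval ?_ (by linarith) ?_
        (Filter.Eventually.of_forall hf0) (hf.intervalIntegrable _ _)
      · linarith [neg_abs_le d]
      · linarith [le_abs_self d]
    have hTd : 0 < T + |d| := by positivity
    calc _ ≤ (2 * T)⁻¹ * ∫ c in (-(T + |d|))..(T + |d|), f c :=
          mul_le_mul_of_nonneg_left hle (by positivity)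
      _ = _ := by
          simp only [Function.comp_apply]
          field_simp

/-- A continuous function on a torus, restricted to a line, vanishes if all its mean values against
exponentials vanish. -/
lemma eq_zero_of_isBohrCoeff_zero {n : ℕ} {m : Fin n → ℝ} {φ : ℝ → ℂ}
    {g : C(UnitAddTorus (Fin n), ℂ)} (hφ : ∀ c, φ c = g (torusLine m c))
    (h : ∀ μ, IsBohrCoeff φ μ 0) : φ = 0 := by
  have hφc : Continuous φ := by
    rw [funext hφ]; exact (map_continuous g).comp (continuous_torusLine m)
  by_contra hne
  obtain ⟨c₀, hc₀⟩ := Function.ne_iff.mp hne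
  simp only [Pi.zero_apply] at hc₀
  set δ := ‖φ c₀‖ ^ 2 with hδ
  have hδ0 : 0 < δ := by positivity
  have hcont : Continuous fun x => ‖g (x + torusLine m c₀)‖ ^ 2 := by fun_prop
  have hnhds : ∀ᶠ x in nhds (0 : UnitAddTorus (Fin n)),
      δ / 2 < ‖g (x + torusLine m c₀)‖ ^ 2 := by
    have h0 : δ / 2 < ‖g (0 + torusLine m c₀)‖ ^ 2 := by
      rw [zero_add, ← hφ, ← hδ]
      linarith
    exact (hcont.tendsto 0).eventually (lt_mem_nhds h0)
  obtain ⟨r, hr, hball⟩ := Metric.eventually_nhds_iff.mp hnhds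
  -- Almost periodicity: finitely many points of the line approximate all others, so finitely many
  -- translates of `‖φ‖²` have a sum of at least `δ / 2` everywhere, although each has mean tending
  -- to zero. Only the line is covered, since dependent frequencies need not make it dense in the
  -- torus.
  have htb : TotallyBounded (Set.range (torusLine m)) :=
    isCompact_univ.totallyBounded.subset (Set.subset_univ _)
  obtain ⟨t, hts, htf, hcov⟩ := Metric.finite_approx_of_totallyBounded htb r hr
  obtain ⟨u, rfl⟩ := htf.exists_finset_coe
  have hts' : ∀ x ∈ u, ∃ c, torusLine m c = x := fun x hx => hts hx
  choose! d hd using hts'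
  have hlow : ∀ c, δ / 2 ≤ ∑ x ∈ u, ‖φ (c + (c₀ - d x))‖ ^ 2 := by
    intro c
    obtain ⟨x, hx⟩ := Set.mem_iUnion.mp (hcov ⟨c, rfl⟩)
    obtain ⟨hxu, hxb⟩ := Set.mem_iUnion.mp hx
    have hlt : δ / 2 < ‖φ (c + (c₀ - d x))‖ ^ 2 := by
      have := @hball (torusLine m c - x) (by
        rw [dist_zero_right]
        rwa [Metric.mem_ball, dist_eq_norm] at hxb)
      rw [← hd x hxu, ← torusLine_sub, ← torusLine_add, ← hφ] at this
      rwa [show c + (c₀ - d x) = c - d x + c₀ by ring]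
    exact hlt.le.trans (Finset.single_le_sum (f := fun x => ‖φ (c + (c₀ - d x))‖ ^ 2)
      (fun _ _ => by positivity) hxu)
  have hlim : Filter.Tendsto (fun T : ℝ => ∑ x ∈ u, (2 * T)⁻¹ *
      ∫ c in (-T)..T, ‖φ (c + (c₀ - d x))‖ ^ 2) Filter.atTop (nhds 0) := by
    have := tendsto_finsetSum u fun x _ => tendsto_mean_translate (f := fun c => ‖φ c‖ ^ 2)
      (by fun_prop) (fun c => by positivity) (tendsto_mean_norm_sq hφ h) (c₀ - d x)
    simpa using this
  have hge : δ / 2 ≤ 0 := by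
    refine ge_of_tendsto hlim ?_
    filter_upwards [Filter.eventually_gt_atTop 0] with T hT
    rw [← Finset.mul_sum, ← intervalIntegral.integral_finsetSum
      fun x _ => Continuous.intervalIntegrable (by fun_prop) _ _]
    have := intervalIntegral.integral_mono_on (μ := MeasureTheory.volume) (a := -T) (b := T)
      (by linarith) (intervalIntegrable_const (c := δ / 2)) (Continuous.intervalIntegrable (by fun_prop) _ _)
      fun c _ => hlow c
    rw [intervalIntegral.integral_const, smul_eq_mul] at this
    rw [le_inv_mul_iff₀ (by positivity)]
    linarith
  linarith

/-! ### Cylindrical functions of loop quantum cosmology -/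

/-- On the unit circle `ζ̄ = ζ⁻¹`, so both coefficients of `rotMat` are real, while `dirMat v` is
anti-Hermitian. -/
lemma rotMat_mem_SU2 {v : Space} (hv : v ≠ 0) {ζ : ℂ} (hζ : ‖ζ‖ = 1) : rotMat v ζ ∈ SU2 := by
  have hζ0 : ζ ≠ 0 := norm_ne_zero_iff.mp (by rw [hζ]; exact one_ne_zero)
  refine Matrix.mem_specialUnitaryGroup_iff.mpr ⟨?_, rotMat_mem_SL2 hv hζ0⟩
  have hn0 : (‖v‖ : ℂ) ≠ 0 := by simpa using hv
  have hconj : star ζ = ζ⁻¹ := by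
    rw [Complex.inv_def, Complex.normSq_eq_norm_sq, hζ]; simp
  have hconj' : star ζ⁻¹ = ζ := by rw [← hconj, star_star]
  have hN : (dirMat v).conjTranspose = -dirMat v := by
    simp [dirMat, Matrix.conjTranspose_sum, Matrix.conjTranspose_smul, conjTranspose_tau]
  have hx : star ((ζ + ζ⁻¹) / 2) = (ζ + ζ⁻¹) / 2 := by
    rw [star_div₀, star_add, hconj, hconj', add_comm]; simp
  have hy : star ((ζ - ζ⁻¹) / (Complex.I * ‖v‖)) = (ζ - ζ⁻¹) / (Complex.I * ‖v‖) := by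
    rw [star_div₀, star_sub, hconj, hconj', star_mul']
    simp only [Complex.star_def, Complex.conj_I, Complex.conj_ofReal]
    rw [← neg_sub ζ, neg_mul, neg_div_neg_eq]
  rw [Matrix.mem_unitaryGroup_iff', Matrix.star_eq_conjTranspose, rotMat,
    Matrix.conjTranspose_add, Matrix.conjTranspose_smul, Matrix.conjTranspose_smul, hx, hy, hN,
    Matrix.conjTranspose_one]
  have e : ∀ x y : ℂ, (x • (1 : Mat) + y • -dirMat v) * (x • (1 : Mat) + y • dirMat v) =
      (x ^ 2 + y ^ 2 * ((‖v‖ : ℂ) ^ 2 / 4)) • (1 : Mat) := by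
    intro x y
    have h2 := dirMat_mul_self v
    simp only [Matrix.add_mul, Matrix.mul_add, Matrix.smul_mul, Matrix.mul_smul, Matrix.mul_one,
      Matrix.one_mul, Matrix.neg_mul, h2]
    module
  rw [e]
  convert one_smul ℂ (1 : Mat) using 2
  field_simp
  rw [Complex.I_sq]
  ring

lemma continuous_rotMat_fourier (v : Space) :
    Continuous fun x : UnitAddCircle => rotMat v (fourier 1 x) := by
  have h1 : Continuous fun x : UnitAddCircle => (fourier 1 x : ℂ) := map_continuous _
  have h2 : Continuous fun x : UnitAddCircle => (fourier 1 x : ℂ)⁻¹ :=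
    h1.inv₀ fun x => by rw [fourier_apply]; exact Circle.coe_ne_zero _
  exact (((h1.add h2).div_const 2).smul continuous_const).add
    (((h1.sub h2).div_const _).smul continuous_const)

lemma edgePhase_eq_fourier (a : ℝ) {n : ℕ} (e : Fin n → StraightEdge) (c : ℝ) (j : Fin n) :
    edgePhase a (e j) c = fourier 1 (torusLine (fun j => a * ‖(e j).dir‖) c j) := by
  rw [fourier_torusLine, edgePhase]
  simp

/-- Replacing the phases of the edges by independent unit complex numbers keeps the arguments of `f`
in `SU(2)ⁿ`, where `f` is continuous. -/
lemma CylS.exists_torus {A₀ : SmoothConn} {a : ℝ} (ha : ∀ x v, A₀.1 x v = a • v) {φ : ℝ → ℂ}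
    (hφ : φ ∈ CylS A₀) : ∃ (n : ℕ) (m : Fin n → ℝ) (g : C(UnitAddTorus (Fin n), ℂ)),
      ∀ c, φ c = g (torusLine m c) := by
  obtain ⟨Φ, ⟨n, e, f, hf, hΦ⟩, rfl⟩ := hφ
  refine ⟨n, fun j => a * ‖(e j).dir‖,
    ⟨fun x => f fun j => rotMat (e j).dir (fourier 1 (x j)), ?_⟩, fun c => ?_⟩
  · refine hf.continuousOn.comp_continuous (continuous_pi fun j => ?_) fun x j => ?_
    · exact (continuous_rotMat_fourier _).comp (continuous_apply j)
    · exact rotMat_mem_SU2 (e j).dir_ne (by rw [fourier_apply]; exact Circle.norm_coe _)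
  · simp only [LinearMap.funLeft_apply, hΦ, symmConn_straightEdge ha, ContinuousMap.coe_mk]
    congr 1
    funext j
    rw [edgePhase_eq_fourier]

lemma CylS.eq_zero {A₀ : SmoothConn} {a : ℝ} (ha : ∀ x v, A₀.1 x v = a • v) {φ : ℝ → ℂ}
    (hφ : φ ∈ CylS A₀) (h : ∀ μ, IsBohrCoeff φ μ 0) : φ = 0 := by
  obtain ⟨n, m, g, hg⟩ := CylS.exists_torus ha hφ
  exact eq_zero_of_isBohrCoeff_zero hg h

/-! ### `SU(2)` is a set of uniqueness for holomorphic functions on `SL(2,ℂ)` -/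

/-- The complexified maximal torus. -/
def torusMat (ζ : ℂ) : Mat :=
  Matrix.diagonal ![Complex.exp (Complex.I * ζ), Complex.exp (-(Complex.I * ζ))]

lemma torusMat_mem_SL2 (ζ : ℂ) : torusMat ζ ∈ SL2 := by
  simp [SL2, torusMat, ← Complex.exp_add]

lemma mul_mem_SL2 {g h : Mat} (hg : g ∈ SL2) (hh : h ∈ SL2) : g * h ∈ SL2 := by
  simp only [SL2, Set.mem_ofPred_eq] at *
  rw [Matrix.det_mul, hg, hh, one_mul]

lemma mul_mem_SU2 {g h : Mat} (hg : g ∈ SU2) (hh : h ∈ SU2) : g * h ∈ SU2 :=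
  (Matrix.specialUnitaryGroup (Fin 2) ℂ).mul_mem hg hh

lemma torusMat_mem_SU2 (c : ℝ) : torusMat c ∈ SU2 := by
  refine Matrix.mem_specialUnitaryGroup_iff.mpr ⟨?_, torusMat_mem_SL2 c⟩
  rw [Matrix.mem_unitaryGroup_iff', Matrix.star_eq_conjTranspose, torusMat,
    Matrix.diagonal_conjTranspose, Matrix.diagonal_mul_diagonal, ← Matrix.diagonal_one]
  congr 1
  funext i
  fin_cases i <;> simp [← Complex.exp_conj, ← Complex.exp_add]

open scoped ComplexOrder in
/-- The Cartan decomposition of `SL(2,ℂ)`. -/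
lemma exists_cartan {g : Mat} (hg : g ∈ SL2) :
    ∃ k₁ ∈ SU2, ∃ k₂ ∈ SU2, ∃ ζ : ℂ, g = k₁ * torusMat ζ * k₂ := by
  have hH : (g.conjTranspose * g).IsHermitian := Matrix.isHermitian_conjTranspose_mul_self g
  set U : Mat := (hH.eigenvectorUnitary : Mat) with hU
  have hU1 : U.conjTranspose * U = 1 := Matrix.mem_unitaryGroup_iff'.mp hH.eigenvectorUnitary.2
  have hU2 : U * U.conjTranspose = 1 := Matrix.mem_unitaryGroup_iff.mp hH.eigenvectorUnitary.2
  set d := hH.eigenvalues with hd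
  set X := g * U with hX
  -- Singular values: diagonalizing `g* g` makes the columns of `X = g U` orthogonal with squared
  -- lengths `d i`, whose product is one.
  have hXX : X.conjTranspose * X = Matrix.diagonal (fun i => (d i : ℂ)) := by
    have hs := hH.conjStarAlgAut_star_eigenvectorUnitary
    rw [Unitary.conjStarAlgAut_star_apply] at hs
    rw [hX, Matrix.conjTranspose_mul]
    simp only [Matrix.mul_assoc] at hs ⊢
    exact hs
  have hdetg : g.det = 1 := hg
  have hdet : X.det = U.det := by rw [hX, Matrix.det_mul, hdetg, one_mul]
  have hUdet : star U.det * U.det = 1 := by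
    rw [← Matrix.det_conjTranspose, ← Matrix.det_mul, hU1, Matrix.det_one]
  have hprod : d 0 * d 1 = 1 := by
    have := congrArg Matrix.det hXX
    rw [Matrix.det_mul, Matrix.det_conjTranspose, hdet, hUdet, Matrix.det_diagonal,
      Fin.prod_univ_two] at this
    exact_mod_cast this.symm
  have hnn : ∀ i, 0 ≤ d i := (Matrix.posSemidef_conjTranspose_mul_self g).eigenvalues_nonneg
  have hd0 : 0 < d 0 := lt_of_le_of_ne (hnn 0) fun h => by rw [← h] at hprod; simp at hprod
  set r : ℂ := (Real.sqrt (d 0) : ℂ) with hr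
  have hr0 : r ≠ 0 := by
    rw [hr]; exact_mod_cast (Real.sqrt_pos.mpr hd0).ne'
  have hrr : r * r = d 0 := by rw [hr]; exact_mod_cast Real.mul_self_sqrt hd0.le
  have hrstar : star r = r := Complex.conj_ofReal _
  have hd1 : (d 1 : ℂ) = (r * r)⁻¹ := by
    rw [hrr]
    exact_mod_cast (eq_inv_of_mul_eq_one_right hprod)
  have hδ0 : U.det ≠ 0 := right_ne_zero_of_mul_eq_one hUdet
  have hδs : star U.det = U.det⁻¹ := eq_inv_of_mul_eq_one_left hUdet
  -- The columns of `X` have lengths `r` and `r⁻¹` and are normalized. The phase `det U` is moved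
  -- from the left factor to the right one so that both have determinant one, and `ζ` is chosen so
  -- that `exp(iζ) = r`.
  refine ⟨X * Matrix.diagonal ![r⁻¹ * U.det⁻¹, r], ?_,
    Matrix.diagonal ![U.det, 1] * U.conjTranspose, ?_, -Complex.I * Complex.log r, ?_⟩
  · refine Matrix.mem_specialUnitaryGroup_iff.mpr ⟨?_, ?_⟩
    · rw [Matrix.mem_unitaryGroup_iff', Matrix.star_eq_conjTranspose, Matrix.conjTranspose_mul,
        Matrix.mul_assoc, ← Matrix.mul_assoc _ X, hXX, Matrix.diagonal_conjTranspose,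
        Matrix.diagonal_mul_diagonal, Matrix.diagonal_mul_diagonal, ← Matrix.diagonal_one]
      congr 1
      funext i
      fin_cases i
      · simp only [Fin.zero_eta, Pi.star_apply, Matrix.cons_val_zero, star_mul', star_inv₀, hrstar,
          hδs, ← hrr]
        field_simp
      · simp only [Fin.mk_one, Pi.star_apply, Matrix.cons_val_one, Matrix.cons_val_fin_one, hrstar,
          hd1]
        field_simp
    · rw [Matrix.det_mul, hdet, Matrix.det_diagonal, Fin.prod_univ_two]
      simp only [Matrix.cons_val_zero, Matrix.cons_val_one]
      field_simp
  · refine Matrix.mem_specialUnitaryGroup_iff.mpr ⟨?_, ?_⟩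
    · rw [Matrix.mem_unitaryGroup_iff, Matrix.star_eq_conjTranspose, Matrix.conjTranspose_mul,
        Matrix.conjTranspose_conjTranspose, Matrix.mul_assoc, ← Matrix.mul_assoc _ U, hU1, one_mul,
        Matrix.diagonal_conjTranspose, Matrix.diagonal_mul_diagonal, ← Matrix.diagonal_one]
      congr 1
      funext i
      fin_cases i
      · simpa only [Fin.zero_eta, Pi.star_apply, Matrix.cons_val_zero, mul_comm U.det] using hUdet
      · simp
    · rw [Matrix.det_mul, Matrix.det_conjTranspose, Matrix.det_diagonal, Fin.prod_univ_two, hδs]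
      simp [hδ0]
  · have e1 : Complex.I * (-Complex.I * Complex.log r) = Complex.log r := by
      linear_combination (-Complex.log r) * Complex.I_sq
    rw [torusMat, e1, Complex.exp_neg, Complex.exp_log hr0]
    rw [Matrix.mul_assoc, Matrix.mul_assoc, ← Matrix.mul_assoc (Matrix.diagonal _)
      (Matrix.diagonal _), ← Matrix.mul_assoc (Matrix.diagonal _ * Matrix.diagonal _),
      Matrix.diagonal_mul_diagonal, Matrix.diagonal_mul_diagonal]
    have e2 : Matrix.diagonal (fun i => ![r⁻¹ * U.det⁻¹, r] i *
        ![r, r⁻¹] i * ![U.det, 1] i) = (1 : Mat) := by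
      rw [← Matrix.diagonal_one]
      congr 1
      funext i
      fin_cases i
      · simp only [Fin.zero_eta, Matrix.cons_val_zero]
        field_simp
      · simp [hr0]
    rw [e2, one_mul, hX, Matrix.mul_assoc, hU2, mul_one]

/-- With the `SU(2)` factors of the Cartan decomposition fixed, `h` is an entire function of the
torus parameter, and it vanishes at real parameters, where the product lies in `SU(2)`. -/
lemma eq_zero_on_SL2 {h : Mat → ℂ} (hd : DifferentiableOn ℂ h SL2) (h0 : ∀ g ∈ SU2, h g = 0)
    {g : Mat} (hg : g ∈ SL2) : h g = 0 := by
  obtain ⟨k₁, hk₁, k₂, hk₂, ζ, rfl⟩ := exists_cartan hg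
  have hpath : Differentiable ℂ fun ζ => k₁ * torusMat ζ * k₂ := by
    refine differentiable_pi.mpr fun i => differentiable_pi.mpr fun j => ?_
    simp only [torusMat, Matrix.mul_apply, Matrix.diagonal_apply, Fin.sum_univ_two]
    fin_cases i <;> fin_cases j <;> simp <;> fun_prop
  have hmem : ∀ ζ, k₁ * torusMat ζ * k₂ ∈ SL2 := fun ζ =>
    mul_mem_SL2 (mul_mem_SL2 (SU2_subset_SL2 hk₁) (torusMat_mem_SL2 ζ)) (SU2_subset_SL2 hk₂)
  have hcomp : Differentiable ℂ fun ζ => h (k₁ * torusMat ζ * k₂) :=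
    differentiableOn_univ.mp (hd.comp hpath.differentiableOn fun ζ _ => hmem ζ)
  have := entire_eq_of_eq_on_real hcomp (differentiable_const 0) fun c =>
    h0 _ (mul_mem_SU2 (mul_mem_SU2 hk₁ (torusMat_mem_SU2 c)) hk₂)
  exact congrFun this ζ

/-- The variables are released from `SU(2)` to `SL(2,ℂ)` one at a time; `S` is the set of those
already released. -/
lemma eq_zero_on_SL2_pi {m : ℕ} {h : (Fin m → Mat) → ℂ}
    (hd : DifferentiableOn ℂ h {g | ∀ i, g i ∈ SL2}) (h0 : ∀ g, (∀ i, g i ∈ SU2) → h g = 0)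
    {g : Fin m → Mat} (hg : ∀ i, g i ∈ SL2) : h g = 0 := by
  have key : ∀ S : Finset (Fin m), ∀ g : Fin m → Mat, (∀ i ∈ S, g i ∈ SL2) →
      (∀ i ∉ S, g i ∈ SU2) → h g = 0 := by
    intro S
    induction S using Finset.induction_on with
    | empty => exact fun g _ hg => h0 g fun i => hg i (by simp)
    | insert j S hj ih =>
      intro g h1 h2
      have h3 : ∀ i, i ≠ j → g i ∈ SL2 := fun i hij => by
        by_cases hi : i ∈ S
        · exact h1 i (by simp [hi])
        · exact SU2_subset_SL2 (h2 i (by simp [hi, hij]))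
      have hupd : Differentiable ℂ fun x : Mat => Function.update g j x := by
        refine differentiable_pi.mpr fun i => ?_
        by_cases hij : i = j
        · subst hij; simp
        · simp [Function.update_of_ne hij]
      have hdd : DifferentiableOn ℂ (fun x => h (Function.update g j x)) SL2 := by
        refine hd.comp hupd.differentiableOn fun x hx i => ?_
        by_cases hij : i = j
        · subst hij; simpa using hx
        · simpa [Function.update_of_ne hij] using h3 i hij
      have := eq_zero_on_SL2 hdd (fun x hx => ih _ (fun i hi => ?_) fun i hi => ?_)
        (h1 j (by simp))
      · simpa using this
      · have hij : i ≠ j := fun e => hj (e ▸ hi)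
        simpa [Function.update_of_ne hij] using h3 i hij
      · by_cases hij : i = j
        · subst hij; simpa using hx
        · simpa [Function.update_of_ne hij] using h2 i (by simp [hi, hij])
  exact key Finset.univ g (fun i _ => hg i) (by simp)

/-! ### Holonomies along subdivided straight edges -/

lemma hasDerivAt_affine (x v : Space) (k l t : ℝ) :
    HasDerivAt (fun t : ℝ => x + (k * t - l) • v) (k • v) t := by
  have h : HasDerivAt (fun t : ℝ => k * t - l) k t := by
    simpa using ((hasDerivAt_id t).const_mul k).sub_const l
  exact (h.smul_const v).const_add x

lemma analyticOn_affine (x v : Space) (k l : ℝ) (s : Set ℝ) :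
    AnalyticOn ℝ (fun t : ℝ => x + (k * t - l) • v) s :=
  analyticOn_const.add (((analyticOn_const.mul analyticOn_id).sub analyticOn_const).smul
    analyticOn_const)

/-- The concatenation of two straight segments, each run through in half of the time. -/
def concatCurve (p x q : Space) (hpx : p ≠ x) (hxq : x ≠ q) : Curve where
  toFun t := if t ≤ 1 / 2 then p + (2 * t - 0) • (x - p) else x + (2 * t - 1) • (q - x)
  piecewiseAnalytic := by
    have main : ∀ (y v : Space) (l a b : ℝ) (f : ℝ → Space), a < b → v ≠ 0 →
        Set.EqOn f (fun t => y + (2 * t - l) • v) (Set.Icc a b) →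
        AnalyticOn ℝ f (Set.Icc a b) ∧ ∀ t ∈ Set.Icc a b, derivWithin f (Set.Icc a b) t ≠ 0 := by
      intro y v l a b f hab hv hf
      refine ⟨(analyticOn_affine y v 2 l _).congr hf, fun t ht => ?_⟩
      rw [derivWithin_congr hf (hf ht), (hasDerivAt_affine y v 2 l t).hasDerivWithinAt.derivWithin
        (uniqueDiffOn_Icc hab t ht)]
      exact smul_ne_zero two_ne_zero hv
    refine ⟨2, ![0, 1 / 2, 1], ?_, rfl, rfl, ?_⟩
    · rw [Fin.strictMono_iff_lt_succ]
      intro i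
      fin_cases i
      · change (0 : ℝ) < 1 / 2
        norm_num
      · change (1 / 2 : ℝ) < 1
        norm_num
    · intro i
      fin_cases i
      · exact main p (x - p) 0 0 (1 / 2) _ (by norm_num) (sub_ne_zero.mpr hpx.symm)
          fun t ht => if_pos ht.2
      · refine main x (q - x) 1 (1 / 2) 1 _ (by norm_num) (sub_ne_zero.mpr hxq.symm) fun t ht => ?_
        rcases ht.1.eq_or_lt with h | h
        · rw [← h]
          norm_num
        · exact if_neg (not_le.mpr h)

/-- The composition law speaks of curves that change over at time `1/2`, whereas the straight edge
reaches `x` at time `τ`; a piecewise linear change of parameter reconciles the two. -/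
lemma GenConn.straightEdge_split {S : Set Mat} (A : GenConn S) {p x q : Space} (hpq : p ≠ q)
    (hpx : p ≠ x) (hxq : x ≠ q) {τ : ℝ} (hτ : τ ∈ Set.Ioo (0 : ℝ) 1) (hx : x = p + τ • (q - p)) :
    A.toFun (StraightEdge.mk p q hpq).toCurve =
      A.toFun (StraightEdge.mk x q hxq).toCurve * A.toFun (StraightEdge.mk p x hpx).toCurve := by
  have hcomp : A.toFun (concatCurve p x q hpx hxq) =
      A.toFun (StraightEdge.mk x q hxq).toCurve * A.toFun (StraightEdge.mk p x hpx).toCurve := by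
    refine A.comp _ _ _ (fun t ht => ?_) fun t ht => ?_
    · simp only [concatCurve, StraightEdge.toCurve, if_pos ht.2, sub_zero]
    · rcases ht.1.eq_or_lt with h | h
      · rw [← h]
        norm_num [concatCurve, StraightEdge.toCurve]
      · simp only [concatCurve, StraightEdge.toCurve, if_neg (not_le.mpr h)]
  rw [← hcomp]
  symm
  refine A.reparam _ _ (fun t => if t ≤ 1 / 2 then 2 * τ * t else τ + (2 * t - 1) * (1 - τ))
    ?_ ?_ ?_ ?_ ⟨{1 / 2}, Set.finite_singleton _, ?_⟩ ?_
  · refine Continuous.continuousOn (Continuous.if_le (by fun_prop) (by fun_prop) continuous_id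
      continuous_const fun t ht => ?_)
    rw [ht]; ring
  · intro s _ t _ hst
    have h1 := hτ.1
    have h2 := hτ.2
    simp only
    split_ifs with h3 h4 h4
    · nlinarith
    · nlinarith
    · linarith
    · nlinarith
  · norm_num
  · norm_num
  · rintro t ⟨_, ht⟩
    rcases lt_or_gt_of_ne ht with h | h
    · have : DifferentiableAt ℝ (fun t : ℝ => 2 * τ * t) t := by fun_prop
      refine this.congr_of_eventuallyEq ?_
      filter_upwards [eventually_lt_nhds h] with y hy
      exact if_pos hy.le
    · have : DifferentiableAt ℝ (fun t : ℝ => τ + (2 * t - 1) * (1 - τ)) t := by fun_prop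
      refine this.congr_of_eventuallyEq ?_
      filter_upwards [eventually_gt_nhds h] with y hy
      exact if_neg (not_le.mpr hy)
  · intro t _
    simp only [concatCurve, StraightEdge.toCurve]
    split_ifs with h
    · rw [hx]; module
    · rw [hx]; module

/-- The inverse is written as the adjugate, which is polynomial, so that words in edges stay
holomorphic on all matrices. -/
lemma GenConn.straightEdge_reverse (A : GenConn SL2) {p q : Space} (hpq : p ≠ q) :
    A.toFun (StraightEdge.mk q p hpq.symm).toCurve =
      (A.toFun (StraightEdge.mk p q hpq).toCurve).adjugate := by
  have h := A.inv (StraightEdge.mk p q hpq).toCurve (StraightEdge.mk q p hpq.symm).toCurve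
    fun t _ => by simp only [StraightEdge.toCurve]; module
  have hdet : (A.toFun (StraightEdge.mk p q hpq).toCurve).det = 1 := A.mem _
  have h2 := congrArg (· * (A.toFun (StraightEdge.mk p q hpq).toCurve).adjugate) h
  simpa [Matrix.mul_assoc, Matrix.mul_adjugate, hdet] using h2

/-! ### Straight edges as words in the edges of a graph -/

/-- The holonomies along `e` are a holomorphic function of the holonomies along the `d_j`. -/
def IsWord {m : ℕ} (d : Fin m → StraightEdge) (e : StraightEdge) : Prop :=
  ∃ w : (Fin m → Mat) → Mat, Differentiable ℂ w ∧ (∀ g, (∀ i, g i ∈ SL2) → w g ∈ SL2) ∧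
    ∀ A : GenConn SL2, A.toFun e.toCurve = w fun j => A.toFun (d j).toCurve

lemma differentiable_mat_iff {E : Type*} [NormedAddCommGroup E] [NormedSpace ℂ E] {u : E → Mat} :
    Differentiable ℂ u ↔ ∀ i j, Differentiable ℂ fun x => u x i j :=
  (differentiable_pi (Φ := u)).trans
    (forall_congr' fun i => differentiable_pi (Φ := fun x => u x i))

lemma isWord_self {m : ℕ} (d : Fin m → StraightEdge) (j : Fin m) : IsWord d (d j) :=
  ⟨fun g => g j, differentiable_pi.mp differentiable_id j, fun _ hg => hg j, fun _ => rfl⟩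

lemma IsWord.reverse {m : ℕ} {d : Fin m → StraightEdge} {p q : Space} {hpq : p ≠ q}
    (h : IsWord d ⟨p, q, hpq⟩) : IsWord d ⟨q, p, hpq.symm⟩ := by
  obtain ⟨w, hw, hm, hA⟩ := h
  refine ⟨fun g => (w g).adjugate, ?_, fun g hg => ?_, fun A => ?_⟩
  · replace hw := differentiable_mat_iff.mp hw
    refine differentiable_mat_iff.mpr fun i j => ?_
    simp only [Matrix.adjugate_fin_two]
    fin_cases i <;> fin_cases j
    · exact hw 1 1
    · exact (hw 0 1).neg
    · exact (hw 1 0).neg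
    · exact hw 0 0
  · have : (w g).det = 1 := hm g hg
    change (w g).adjugate.det = 1
    rw [Matrix.det_adjugate, this, one_pow]
  · rw [A.straightEdge_reverse hpq, hA]

lemma IsWord.concat {m : ℕ} {d : Fin m → StraightEdge} {p x q : Space} {hpx : p ≠ x} {hxq : x ≠ q}
    (h₁ : IsWord d ⟨p, x, hpx⟩) (h₂ : IsWord d ⟨x, q, hxq⟩) (hpq : p ≠ q) {τ : ℝ}
    (hτ : τ ∈ Set.Ioo (0 : ℝ) 1) (hx : x = p + τ • (q - p)) : IsWord d ⟨p, q, hpq⟩ := by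
  obtain ⟨w₁, hw₁, hm₁, hA₁⟩ := h₁
  obtain ⟨w₂, hw₂, hm₂, hA₂⟩ := h₂
  refine ⟨fun g => w₂ g * w₁ g, ?_, fun g hg => mul_mem_SL2 (hm₂ g hg) (hm₁ g hg), fun A => ?_⟩
  · replace hw₁ := differentiable_mat_iff.mp hw₁
    replace hw₂ := differentiable_mat_iff.mp hw₂
    refine differentiable_mat_iff.mpr fun i j => ?_
    simp only [Matrix.mul_apply, Fin.sum_univ_two]
    exact ((hw₂ i 0).mul (hw₁ 0 j)).add ((hw₂ i 1).mul (hw₁ 1 j))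
  · rw [A.straightEdge_split hpq hpx hxq hτ hx, hA₁, hA₂]

/-- The open segment between two points, in parametric form. -/
def oSeg (p q : Space) : Set Space := {x | ∃ θ ∈ Set.Ioo (0 : ℝ) 1, x = p + θ • (q - p)}

lemma oSeg_symm (p q : Space) : oSeg p q = oSeg q p := by
  have h : ∀ p q, oSeg p q ⊆ oSeg q p := by
    rintro p q x ⟨θ, hθ, rfl⟩
    exact ⟨1 - θ, ⟨by linarith [hθ.2], by linarith [hθ.1]⟩, by module⟩
  exact (h p q).antisymm (h q p)

lemma left_notMem_oSeg {p q : Space} (hpq : p ≠ q) : p ∉ oSeg p q := by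
  rintro ⟨θ, hθ, h⟩
  have : θ • (q - p) = 0 := by simpa using h
  rcases smul_eq_zero.mp this with h | h
  · exact hθ.1.ne' h
  · exact hpq (sub_eq_zero.mp h).symm

lemma oSeg_subset_left {p x q : Space} (hx : x ∈ oSeg p q) : oSeg p x ⊆ oSeg p q := by
  obtain ⟨τ, hτ, rfl⟩ := hx
  rintro y ⟨θ, hθ, rfl⟩
  exact ⟨θ * τ, ⟨mul_pos hθ.1 hτ.1, by nlinarith [hθ.1, hθ.2, hτ.1, hτ.2]⟩, by module⟩

lemma oSeg_subset_right {p x q : Space} (hx : x ∈ oSeg p q) : oSeg x q ⊆ oSeg p q := by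
  rw [oSeg_symm x q, oSeg_symm p q]
  rw [oSeg_symm p q] at hx
  exact oSeg_subset_left hx

/-- The points of a straight edge. -/
def StraightEdge.pts (e : StraightEdge) : Set Space :=
  {x | ∃ t ∈ Set.Icc (0 : ℝ) 1, x = e.src + t • e.dir}

lemma StraightEdge.src_mem_pts (e : StraightEdge) : e.src ∈ e.pts := ⟨0, by simp, by simp⟩

lemma StraightEdge.tgt_mem_pts (e : StraightEdge) : e.tgt ∈ e.pts := ⟨1, by simp, by simp [dir]⟩

lemma StraightEdge.oSeg_subset_pts {e : StraightEdge} {p q : Space} (hp : p ∈ e.pts)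
    (hq : q ∈ e.pts) : oSeg p q ⊆ e.pts := by
  obtain ⟨s, hs, rfl⟩ := hp
  obtain ⟨t, ht, rfl⟩ := hq
  rintro x ⟨θ, hθ, rfl⟩
  refine ⟨s + θ * (t - s), ⟨?_, ?_⟩, by module⟩
  · nlinarith [hs.1, ht.1, hθ.1, hθ.2]
  · nlinarith [hs.2, ht.2, hθ.1, hθ.2]

/-- The vertices of the subdivision of a family of straight edges: their end points and their
transversal intersections. -/
def vertices {n : ℕ} (e : Fin n → StraightEdge) : Set Space :=
  Set.range (fun i => (e i).src) ∪ Set.range (fun i => (e i).tgt) ∪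
    ⋃ i, ⋃ j, {x | x ∈ (e i).pts ∧ x ∈ (e j).pts ∧ ¬∃ k : ℝ, (e j).dir = k • (e i).dir}

/-- Two edges with non-parallel directions meet in at most one point; parallel ones, which may
overlap in a segment, contribute only their end points. -/
lemma finite_vertices {n : ℕ} (e : Fin n → StraightEdge) : (vertices e).Finite := by
  refine ((Set.finite_range _).union (Set.finite_range _)).union
    (Set.finite_iUnion fun i => Set.finite_iUnion fun j => Set.Subsingleton.finite ?_)
  rintro x ⟨⟨s, -, hxs⟩, ⟨t, -, hxt⟩, hn⟩ y ⟨⟨s', -, hys⟩, ⟨t', -, hyt⟩, -⟩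
  have h : (s - s') • (e i).dir = (t - t') • (e j).dir := by
    have h1 : x - y = (s - s') • (e i).dir := by rw [hxs, hys]; module
    have h2 : x - y = (t - t') • (e j).dir := by rw [hxt, hyt]; module
    rw [← h1, h2]
  have htt : t = t' := by
    by_contra hne
    have hne' : t - t' ≠ 0 := sub_ne_zero.mpr hne
    exact hn ⟨(t - t')⁻¹ * (s - s'), by rw [mul_smul, h, inv_smul_smul₀ hne']⟩
  rw [hxt, hyt, htt]

/-- The edges of the subdivision: pairs of neighbouring vertices on one of the given edges, in a
fixed orientation. -/
def subdivision {n : ℕ} (e : Fin n → StraightEdge) : Set (Space × Space) :=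
  {d | d.1 ∈ vertices e ∧ d.2 ∈ vertices e ∧ (∃ i, d.1 ∈ (e i).pts ∧ d.2 ∈ (e i).pts) ∧
    (∀ x ∈ vertices e, x ∉ oSeg d.1 d.2) ∧ WellOrderingRel d.1 d.2}

lemma finite_subdivision {n : ℕ} (e : Fin n → StraightEdge) : (subdivision e).Finite :=
  ((finite_vertices e).prod (finite_vertices e)).subset fun _ h => ⟨h.1, h.2.1⟩

lemma ne_of_mem_subdivision {n : ℕ} {e : Fin n → StraightEdge} {d : Space × Space}
    (hd : d ∈ subdivision e) : d.1 ≠ d.2 := fun h => by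
  have := hd.2.2.2.2
  rw [h] at this
  exact irrefl_of WellOrderingRel _ this

/-- Two overlapping segments on a line, neither of which has an end point of the other one in its
interior, coincide. -/
lemma eq_of_overlap {p q p' q' : Space} {s t k : ℝ} (hk : 0 < k) (hs : s ∈ Set.Ioo (0 : ℝ) 1)
    (ht : t ∈ Set.Ioo (0 : ℝ) 1) (hx : p + s • (q - p) = p' + t • (q' - p'))
    (hdir : q' - p' = k • (q - p)) (hp' : p' ∉ oSeg p q) (hq' : q' ∉ oSeg p q)
    (hp : p ∉ oSeg p' q') (hq : q ∉ oSeg p' q') : p' = p ∧ q' = q := by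
  -- In the coordinate with `p` at `0` and `q` at `1`, the second segment is `[a, a + k]` with `a =
  -- s - t * k`. As it shares the interior point `s`, the exclusions of `p'` and `q'` force `a ≤ 0`
  -- and `a + k ≥ 1`; those of `p` and `q` then force equality.
  have e1 : p' = p + (s - t * k) • (q - p) := by
    rw [hdir] at hx
    have : p' = p + s • (q - p) - t • k • (q - p) := by rw [hx]; module
    rw [this]; module
  have e2 : q' = p + (s - t * k + k) • (q - p) := by
    have : q' = p' + k • (q - p) := by rw [← hdir]; module
    rw [this, e1]; module
  have htk : 0 < t * k := mul_pos ht.1 hk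
  have htk' : t * k < k := by nlinarith [ht.2]
  set a := s - t * k with ha
  have ha0 : a ≤ 0 := by
    by_contra! h
    exact hp' ⟨a, ⟨h, by linarith [hs.2]⟩, e1⟩
  have hb1 : 1 ≤ a + k := by
    by_contra! h
    exact hq' ⟨a + k, ⟨by linarith [hs.1], h⟩, e2⟩
  have e3 : p = p' + (-a / k) • (q' - p') := by
    rw [hdir, smul_smul, div_mul_cancel₀ _ hk.ne', e1]; module
  have e4 : q = p' + ((1 - a) / k) • (q' - p') := by
    rw [hdir, smul_smul, div_mul_cancel₀ _ hk.ne', e1]; module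
  have ha1 : a = 0 := by
    by_contra h
    have hlt : a < 0 := lt_of_le_of_ne ha0 h
    exact hp ⟨-a / k, ⟨div_pos (by linarith) hk, by rw [div_lt_one hk]; linarith⟩, e3⟩
  have hk1 : k = 1 := by
    by_contra h
    have hlt : 1 < k := lt_of_le_of_ne (by linarith) (Ne.symm h)
    exact hq ⟨(1 - a) / k, ⟨div_pos (by linarith) hk, by rw [div_lt_one hk]; linarith⟩, e4⟩
  refine ⟨by rw [e1, ha1]; module, by rw [e2, ha1, hk1]; module⟩

/-- An interior point of a subdivided edge is not a vertex, so a second edge through it has it as an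
interior point too, and the given edges carrying the two must be parallel. Overlapping parallel
pieces without interior vertices coincide. -/
lemma subdivision_inter {n : ℕ} {e : Fin n → StraightEdge} {d d' : Space × Space}
    (hd : d ∈ subdivision e) (hd' : d' ∈ subdivision e) (hne : d ≠ d') {s t : ℝ}
    (hs : s ∈ Set.Icc (0 : ℝ) 1) (ht : t ∈ Set.Icc (0 : ℝ) 1)
    (hx : d.1 + s • (d.2 - d.1) = d'.1 + t • (d'.2 - d'.1)) : s = 0 ∨ s = 1 := by
  by_contra! hcon
  have hs' : s ∈ Set.Ioo (0 : ℝ) 1 :=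
    ⟨lt_of_le_of_ne hs.1 hcon.1.symm, lt_of_le_of_ne hs.2 hcon.2⟩
  have hneq := ne_of_mem_subdivision hd
  obtain ⟨hpV, hqV, ⟨i, hpi, hqi⟩, hempty, hord⟩ := hd
  obtain ⟨hpV', hqV', ⟨j, hpj, hqj⟩, hempty', hord'⟩ := hd'
  obtain ⟨p, q⟩ := d
  obtain ⟨p', q'⟩ := d'
  simp only at *
  have hxo : p + s • (q - p) ∈ oSeg p q := ⟨s, hs', rfl⟩
  have hxV : p + s • (q - p) ∉ vertices e := fun h => hempty _ h hxo
  have ht' : t ∈ Set.Ioo (0 : ℝ) 1 := by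
    refine ⟨lt_of_le_of_ne ht.1 fun h => hxV ?_, lt_of_le_of_ne ht.2 fun h => hxV ?_⟩
    · rw [hx, ← h]; simpa using hpV'
    · rw [hx, h]; simpa using hqV'
  have hpar : ∃ k : ℝ, (e j).dir = k • (e i).dir := by
    by_contra hn
    refine hxV (Or.inr (Set.mem_iUnion₂.mpr ⟨i, j, ?_, ?_, hn⟩))
    · exact StraightEdge.oSeg_subset_pts hpi hqi hxo
    · exact StraightEdge.oSeg_subset_pts hpj hqj ⟨t, ht', hx⟩
  obtain ⟨k, hk, hkd⟩ : ∃ k : ℝ, k ≠ 0 ∧ q' - p' = k • (q - p) := by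
    obtain ⟨k, hk⟩ := hpar
    have hk0 : k ≠ 0 := fun h => (e j).dir_ne (by rw [hk, h, zero_smul])
    obtain ⟨a, -, ha⟩ := hpi
    obtain ⟨b, -, hb⟩ := hqi
    obtain ⟨a', -, ha'⟩ := hpj
    obtain ⟨b', -, hb'⟩ := hqj
    have h1 : q - p = (b - a) • (e i).dir := by rw [ha, hb]; module
    have h2 : q' - p' = ((b' - a') * k) • (e i).dir := by rw [ha', hb', hk]; module
    have hba : b - a ≠ 0 := fun h => hneq (by
      rw [h, zero_smul] at h1; exact (sub_eq_zero.mp h1).symm)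
    have hba' : b' - a' ≠ 0 := fun h => by
      rw [h, zero_mul, zero_smul] at h2
      have : p' = q' := (sub_eq_zero.mp h2).symm
      rw [this] at hord'
      exact irrefl_of WellOrderingRel _ hord'
    refine ⟨(b' - a') * k / (b - a), by positivity, ?_⟩
    rw [h1, h2, smul_smul, div_mul_cancel₀ _ hba]
  -- For `k < 0` the second piece is traversed backwards, and the two would be the same segment in
  -- opposite orientations, which the well-ordering excludes.
  rcases lt_or_gt_of_ne hk with hneg | hpos
  · have h := eq_of_overlap (p := p) (q := q) (p' := q') (q' := p') (s := s) (t := 1 - t) (k := -k)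
      (by linarith) hs' ⟨by linarith [ht'.2], by linarith [ht'.1]⟩ (by rw [hx]; module)
      (by rw [neg_smul, ← hkd]; module) (hempty _ hqV') (hempty _ hpV')
      (by rw [oSeg_symm]; exact hempty' _ hpV) (by rw [oSeg_symm]; exact hempty' _ hqV)
    rw [h.1, h.2] at hord'
    exact asymm_of WellOrderingRel hord hord'
  · have h := eq_of_overlap hpos hs' ht' hx hkd (hempty _ hpV') (hempty _ hqV') (hempty' _ hpV)
      (hempty' _ hqV)
    exact hne (by rw [h.1, h.2])

/-- The subdivided edges form a graph. -/
lemma isGraph_of_subdivision {n m : ℕ} {e : Fin n → StraightEdge} {d : Fin m → StraightEdge}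
    (hd : ∀ j, ((d j).src, (d j).tgt) ∈ subdivision e)
    (hinj : Function.Injective fun j => ((d j).src, (d j).tgt)) :
    IsGraph fun j => (d j).toCurve := by
  refine ⟨fun j => ⟨?_, ?_, ?_⟩, fun i j hij s hs t ht h => ⟨?_, ?_⟩⟩
  · exact analyticOn_const.add (analyticOn_id.smul analyticOn_const)
  · intro s _ t _ h
    simp only [StraightEdge.toCurve, add_right_inj] at h
    exact smul_left_injective ℝ (d j).dir_ne h
  · intro t ht
    have hd' : HasDerivAt (d j).toCurve.toFun (d j).dir t := by
      have : HasDerivAt (fun t : ℝ => (d j).src + t • ((d j).tgt - (d j).src))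
          ((d j).tgt - (d j).src) t := by
        simpa using ((hasDerivAt_id t).smul_const ((d j).tgt - (d j).src)).const_add (d j).src
      exact this
    rw [hd'.hasDerivWithinAt.derivWithin (uniqueDiffOn_Icc zero_lt_one t ht)]
    exact (d j).dir_ne
  · exact subdivision_inter (hd i) (hd j) (fun hh => hij (hinj hh)) hs ht h
  · exact subdivision_inter (hd j) (hd i) (fun hh => hij (hinj hh).symm) ht hs h.symm

/-- Induction on the number of vertices inside the segment: an interior vertex splits it into two
segments with fewer, and a segment without interior vertices is a `d j` or the reverse of one. -/
lemma isWord_of_subdivision {n m : ℕ} {e : Fin n → StraightEdge} {d : Fin m → StraightEdge}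
    (hd : ∀ x ∈ subdivision e, ∃ j, ((d j).src, (d j).tgt) = x) (i : Fin n) : IsWord d (e i) := by
  have key : ∀ N : ℕ, ∀ p q : Space, ∀ hpq : p ≠ q, p ∈ vertices e → q ∈ vertices e →
      p ∈ (e i).pts → q ∈ (e i).pts → (vertices e ∩ oSeg p q).ncard = N →
      IsWord d ⟨p, q, hpq⟩ := by
    intro N
    induction N using Nat.strong_induction_on with
    | _ N ih =>
      intro p q hpq hpV hqV hpi hqi hN
      have hfin : ∀ x y, (vertices e ∩ oSeg x y).Finite := fun x y =>
        (finite_vertices e).subset Set.inter_subset_left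
      rcases (vertices e ∩ oSeg p q).eq_empty_or_nonempty with h0 | ⟨x, hxV, hx⟩
      · have hemp : ∀ x ∈ vertices e, x ∉ oSeg p q := fun x hx hx' =>
          (Set.eq_empty_iff_forall_notMem.mp h0 x) ⟨hx, hx'⟩
        have hword : ∀ p q : Space, ∀ hpq : p ≠ q, (p, q) ∈ subdivision e →
            IsWord d ⟨p, q, hpq⟩ := by
          intro p q hpq hmem
          obtain ⟨j, hj⟩ := hd _ hmem
          obtain ⟨rfl, rfl⟩ := Prod.mk.inj hj
          exact isWord_self d j
        rcases trichotomous_of WellOrderingRel p q with h | h | h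
        · exact hword p q hpq ⟨hpV, hqV, ⟨i, hpi, hqi⟩, hemp, h⟩
        · exact absurd h hpq
        · exact (hword q p hpq.symm ⟨hqV, hpV, ⟨i, hqi, hpi⟩,
            by simpa only [oSeg_symm q p] using hemp, h⟩).reverse
      · have hxi := StraightEdge.oSeg_subset_pts hpi hqi hx
        have hpx : p ≠ x := fun h => left_notMem_oSeg hpq (h ▸ hx)
        have hxq : x ≠ q := fun h => left_notMem_oSeg hpq.symm (by
          rw [oSeg_symm q p]; exact h ▸ hx)
        have hlt₁ : (vertices e ∩ oSeg p x).ncard < N := by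
          rw [← hN]
          refine Set.ncard_lt_ncard ⟨fun y hy => ⟨hy.1, oSeg_subset_left hx hy.2⟩, fun h => ?_⟩
            (hfin p q)
          have := (h ⟨hxV, hx⟩).2
          rw [oSeg_symm] at this
          exact left_notMem_oSeg hpx.symm this
        have hlt₂ : (vertices e ∩ oSeg x q).ncard < N := by
          rw [← hN]
          refine Set.ncard_lt_ncard ⟨fun y hy => ⟨hy.1, oSeg_subset_right hx hy.2⟩, fun h => ?_⟩
            (hfin p q)
          exact left_notMem_oSeg hxq (h ⟨hxV, hx⟩).2
        obtain ⟨τ, hτ, hxτ⟩ := hx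
        exact (ih _ hlt₁ p x hpx hpV hxV hpi hxi rfl).concat
          (ih _ hlt₂ x q hxq hxV hqV hxi hqi rfl) hpq hτ hxτ
  exact key _ _ _ (e i).ne (Or.inl (Or.inl ⟨i, rfl⟩)) (Or.inl (Or.inr ⟨i, rfl⟩))
    (e i).src_mem_pts (e i).tgt_mem_pts rfl

/-- Finitely many straight edges are words in the edges of a graph of straight edges. -/
lemma exists_graph_isWord {n : ℕ} (e : Fin n → StraightEdge) :
    ∃ (m : ℕ) (d : Fin m → StraightEdge), IsGraph (fun j => (d j).toCurve) ∧
      ∀ i, IsWord d (e i) := by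
  obtain ⟨m, f, hf⟩ := (finite_subdivision e).fin_embedding
  have hmem : ∀ j, f j ∈ subdivision e := fun j => hf ▸ ⟨j, rfl⟩
  let d : Fin m → StraightEdge := fun j => ⟨(f j).1, (f j).2, ne_of_mem_subdivision (hmem j)⟩
  refine ⟨m, d, isGraph_of_subdivision (e := e) (fun j => hmem j) f.injective, fun i =>
    isWord_of_subdivision (fun x hx => ?_) i⟩
  rw [← hf] at hx
  exact hx

/-- A holomorphic cylindrical function that vanishes on the generalized `SU(2)` connections
vanishes. -/
lemma HolCyl.eq_zero {μ : MeasureTheory.Measure (GenConn SU2)} (hμ : IsAshtekarLewandowski μ)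
    {W : GenConn SL2 → ℂ} (hW : W ∈ HolCyl) (h0 : ∀ A : GenConn SU2, W A.complexify = 0) :
    W = 0 := by
  obtain ⟨n, e, f, hf, hWf⟩ := hW
  -- The given edges may cross or overlap, so their holonomies need not be independent; those of the
  -- graph edges are, in the sense of `dense_holonomies`.
  obtain ⟨m, d, hgraph, hword⟩ := exists_graph_isWord e
  choose w hw hm hA using hword
  have hd : DifferentiableOn ℂ (fun g : Fin m → Mat => f fun i => w i g) {g | ∀ i, g i ∈ SL2} :=
    hf.differentiableOn.comp (differentiable_pi.mpr hw).differentiableOn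
      fun g hg i => hm i g hg
  have hval : ∀ A : GenConn SL2, W A = f fun i => w i fun j => A.toFun (d j).toCurve := fun A => by
    rw [hWf]
    congr 1
    funext i
    exact hA i A
  have hSU : ∀ g : Fin m → Mat, (∀ i, g i ∈ SU2) → (f fun i => w i g) = 0 := by
    intro g hg
    have hmaps : Set.MapsTo (fun g : Fin m → Mat => f fun i => w i g)
        (Set.range fun (A : GenConn SU2) j => A.toFun (d j).toCurve) {0} := by
      rintro _ ⟨A, rfl⟩
      exact (hval A.complexify).symm.trans (h0 A)
    have hc : ContinuousWithinAt (fun g : Fin m → Mat => f fun i => w i g)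
        (Set.range fun (A : GenConn SU2) j => A.toFun (d j).toCurve) g := by
      refine (hd.continuousOn g fun i => SU2_subset_SL2 (hg i)).mono ?_
      rintro _ ⟨A, rfl⟩ i
      exact SU2_subset_SL2 (A.mem _)
    have := hc.mem_closure (dense_holonomies hμ hgraph hg) hmaps
    simpa using this
  funext A
  rw [hval]
  exact eq_zero_on_SL2_pi hd hSU fun i => A.mem _

/-! ### The transforms to the holomorphic representations -/

/-- By linearity the fibre over zero decides single-valuedness. Contraction gives `W = 0` almost
everywhere on `SU(2)` connections, faithfulness and continuity remove the null set, and
`HolCyl.eq_zero` extends to `SL(2,ℂ)`. -/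
lemma holTransform_eq_zero_of_fst {μ : MeasureTheory.Measure (GenConn SU2)}
    (hμ : IsAshtekarLewandowski μ) {Chat : Hilb μ →ₗ.[ℂ] Hilb μ}
    (hpos : ∀ x : Chat.domain, 0 ≤ (inner ℂ (x : Hilb μ) (Chat x)).re) {W : GenConn SL2 → ℂ}
    (h : ((0 : Cyl), W) ∈ holTransform μ Chat) : W = 0 := by
  obtain ⟨hW, x, y, hx, hxy, hy⟩ := h
  have := hμ.faithful
  have hx0 : x = 0 := (MeasureTheory.Lp.eq_zero_iff_ae_eq_zero).mpr hx
  subst hx0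
  have hy0 := hxy.eq_zero_of_left hpos
  subst hy0
  have hae : (fun A : GenConn SU2 => W A.complexify) =ᵐ[μ] fun _ => 0 :=
    hy.symm.trans (MeasureTheory.Lp.coeFn_zero _ _ _)
  have heq := ((HolCyl.continuous_complexify hW).ae_eq_iff_eq μ continuous_const).mp hae
  exact HolCyl.eq_zero hμ hW fun A => congrFun heq A

lemma holTransform_eq_zero_of_snd {μ : MeasureTheory.Measure (GenConn SU2)}
    (hμ : IsAshtekarLewandowski μ) {Chat : Hilb μ →ₗ.[ℂ] Hilb μ} (hsa : IsSelfAdjoint Chat)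
    {Φ : Cyl} (h : (Φ, 0) ∈ holTransform μ Chat) : Φ = 0 := by
  obtain ⟨-, x, y, hx, hxy, hy⟩ := h
  have := hμ.faithful
  have hy0 : y = 0 := (MeasureTheory.Lp.eq_zero_iff_ae_eq_zero).mpr hy
  subst hy0
  have hx0 := hxy.eq_zero_of_right (isFormalAdjoint_self hsa)
  subst hx0
  have hae : (Φ : GenConn SU2 → ℂ) =ᵐ[μ] fun _ => 0 :=
    hx.symm.trans (MeasureTheory.Lp.coeFn_zero _ _ _)
  exact Subtype.ext (((Cyl.continuous Φ.2).ae_eq_iff_eq μ continuous_const).mp hae)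

lemma holTransform_unique {μ : MeasureTheory.Measure (GenConn SU2)}
    (hμ : IsAshtekarLewandowski μ) {Chat : Hilb μ →ₗ.[ℂ] Hilb μ}
    (hpos : ∀ x : Chat.domain, 0 ≤ (inner ℂ (x : Hilb μ) (Chat x)).re) {Φ : Cyl}
    {W W' : GenConn SL2 → ℂ} (h : (Φ, W) ∈ holTransform μ Chat)
    (h' : (Φ, W') ∈ holTransform μ Chat) : W = W' := by
  have := (holTransform μ Chat).sub_mem h h'
  rw [Prod.mk_sub_mk, sub_self] at this
  exact sub_eq_zero.mp (holTransform_eq_zero_of_fst hμ hpos this)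

lemma IsBohrCoeff.unique {φ : ℝ → ℂ} {μ : ℝ} {a b : ℂ} (ha : IsBohrCoeff φ μ a)
    (hb : IsBohrCoeff φ μ b) : a = b :=
  tendsto_nhds_unique ha.2 hb.2

lemma holTransformS_eq_zero_of_fst {G γ : ℝ} {A₀ : SmoothConn} {CS : ℝ → ℝ} {a : ℝ}
    (ha : ∀ x v, A₀.1 x v = a • v) {w : ℂ → ℂ}
    (h : ((0 : CylS A₀), w) ∈ holTransformS G γ A₀ CS) : w = 0 := by
  obtain ⟨hd, hmem, hexp⟩ := h
  have h0 := CylS.eq_zero ha hmem fun μ => by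
    obtain ⟨b, hb, hb'⟩ := hexp μ
    rw [hb.unique (isBohrCoeff_zero μ), mul_zero] at hb'
    exact hb'
  exact entire_eq_of_eq_on_real hd (differentiable_const 0) fun c => congrFun h0 c

/-- The factor `exp(-C_S)` on each Bohr coefficient is nonzero, so all coefficients of `φ` vanish.
-/
lemma holTransformS_eq_zero_of_snd {G γ : ℝ} {A₀ : SmoothConn} {CS : ℝ → ℝ} {a : ℝ}
    (ha : ∀ x v, A₀.1 x v = a • v) {φ : CylS A₀}
    (h : (φ, 0) ∈ holTransformS G γ A₀ CS) : φ = 0 := by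
  obtain ⟨-, -, hexp⟩ := h
  refine Subtype.ext (CylS.eq_zero ha φ.2 fun μ => ?_)
  obtain ⟨b, hb, hb'⟩ := hexp μ
  have h0 := hb'.unique (isBohrCoeff_zero μ)
  rcases mul_eq_zero.mp h0 with h1 | h1
  · exact absurd (Complex.ofReal_eq_zero.mp h1) (Real.exp_pos _).ne'
  · rwa [h1] at hb

lemma holTransformS_unique {G γ : ℝ} {A₀ : SmoothConn} {CS : ℝ → ℝ} {a : ℝ}
    (ha : ∀ x v, A₀.1 x v = a • v) {φ : CylS A₀} {w w' : ℂ → ℂ}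
    (h : (φ, w) ∈ holTransformS G γ A₀ CS) (h' : (φ, w') ∈ holTransformS G γ A₀ CS) : w = w' := by
  have := (holTransformS G γ A₀ CS).sub_mem h h'
  rw [Prod.mk_sub_mk, sub_self] at this
  exact sub_eq_zero.mp (holTransformS_eq_zero_of_fst ha this)

/-- Multiplication operators are single-valued if the transform is single-valued and injective. -/
lemma mulGraph_toLinearPMap_graph {V X : Type} [AddCommGroup V] [Module ℂ V]
    {U : Submodule ℂ (V × (X → ℂ))} (h₁ : ∀ W, ((0 : V), W) ∈ U → W = 0)
    (h₂ : ∀ v, (v, (0 : X → ℂ)) ∈ U → v = 0) (F : X → ℂ) :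
    (mulGraph U F).toLinearPMap.graph = mulGraph U F := by
  refine Submodule.toLinearPMap_graph_eq _ ?_
  rintro ⟨v, v'⟩ ⟨W, hW, hW'⟩ (rfl : v = 0)
  rw [h₁ W hW, mul_zero] at hW'
  exact h₂ v' hW'

lemma bProj_graph {G γ : ℝ} {A₀ : SmoothConn} {a : ℝ} (ha : ∀ x v, A₀.1 x v = a • v)
    {μ : MeasureTheory.Measure (GenConn SU2)} (hμ : IsAshtekarLewandowski μ)
    {Chat : Hilb μ →ₗ.[ℂ] Hilb μ}
    (hpos : ∀ x : Chat.domain, 0 ≤ (inner ℂ (x : Hilb μ) (Chat x)).re) (CS : ℝ → ℝ)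
    (s : ℂ → SmoothConnC) :
    (bProj G γ A₀ μ Chat CS s).graph = bProjGraph G γ A₀ μ Chat CS s := by
  refine Submodule.toLinearPMap_graph_eq _ ?_
  rintro ⟨Φ, φ⟩ ⟨W, hW, hWs⟩ (rfl : Φ = 0)
  rw [holTransform_eq_zero_of_fst hμ hpos hW] at hWs
  exact holTransformS_eq_zero_of_snd ha hWs

/-! ### Graphs of dual actions -/

/-- On graphs the dual action is composition of relations, which turns questions about natural
domains into existence statements. -/
lemma mem_graph_dualAct {V W : Type} [AddCommGroup V] [Module ℂ V] [AddCommGroup W] [Module ℂ W]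
    {T : V →ₗ.[ℂ] W} {Λ : W →ₗ.[ℂ] ℂ} {v : V} {y : ℂ} :
    (v, y) ∈ (dualAct T Λ).graph ↔ ∃ w, (v, w) ∈ T.graph ∧ (w, y) ∈ Λ.graph := by
  constructor
  · intro h
    obtain ⟨⟨x, x', hx', hxx⟩, rfl, rfl⟩ := (LinearPMap.mem_graph_iff _).mp h
    subst hxx
    exact ⟨T x', T.mem_graph x', Λ.mem_graph ⟨T x', hx'⟩⟩
  · rintro ⟨w, hT, hΛ⟩
    obtain ⟨x, rfl, rfl⟩ := (LinearPMap.mem_graph_iff _).mp hT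
    obtain ⟨x', hx', rfl⟩ := (LinearPMap.mem_graph_iff _).mp hΛ
    simp only at hx'
    have hmem : (x : V) ∈ (dualAct T Λ).domain := ⟨x, by
      change T x ∈ Λ.domain
      rw [← hx']; exact x'.2, rfl⟩
    refine (LinearPMap.mem_graph_iff _).mpr ⟨⟨x, hmem⟩, rfl, ?_⟩
    change Λ ⟨T x, _⟩ = Λ x'
    congr 1
    exact Subtype.ext hx'.symm

lemma mem_graph_domRestrict {V : Type} [AddCommGroup V] [Module ℂ V] {f : V →ₗ.[ℂ] ℂ}
    {S : Submodule ℂ V} {v : V} {y : ℂ} :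
    (v, y) ∈ (f.domRestrict S).graph ↔ v ∈ S ∧ (v, y) ∈ f.graph := by
  constructor
  · intro h
    obtain ⟨⟨x, hx⟩, rfl, rfl⟩ := (LinearPMap.mem_graph_iff _).mp h
    refine ⟨hx.1, (LinearPMap.mem_graph_iff _).mpr ⟨⟨x, hx.2⟩, rfl, ?_⟩⟩
    exact (LinearPMap.domRestrict_apply rfl).symm
  · rintro ⟨hS, hf⟩
    obtain ⟨x, rfl, rfl⟩ := (LinearPMap.mem_graph_iff _).mp hf
    refine (LinearPMap.mem_graph_iff _).mpr ⟨⟨x, hS, x.2⟩, rfl, ?_⟩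
    exact LinearPMap.domRestrict_apply rfl

lemma mem_graph_toPMap_top {V : Type} [AddCommGroup V] [Module ℂ V] (ψ : Module.Dual ℂ V) (v : V)
    (y : ℂ) : (v, y) ∈ (LinearMap.toPMap ψ ⊤).graph ↔ y = ψ v := by
  rw [LinearPMap.mem_graph_iff]
  constructor
  · rintro ⟨x, rfl, rfl⟩
    rfl
  · rintro rfl
    exact ⟨⟨v, trivial⟩, rfl, rfl⟩

/-! ### Trigonometric polynomials -/

/-- The exponentials `e^{iνz/2}`. -/
def expFn (ν : ℝ) (z : ℂ) : ℂ := Complex.exp (Complex.I * ν * z / 2)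

lemma expFn_mul (ν ν' : ℝ) : expFn ν * expFn ν' = expFn (ν + ν') := by
  funext z
  simp only [expFn, Pi.mul_apply, ← Complex.exp_add]
  congr 1
  push_cast
  ring

lemma expFn_zero : expFn 0 = 1 := by funext z; simp [expFn]

/-- The algebra of trigonometric polynomials. -/
def trigPoly : Subalgebra ℂ (ℂ → ℂ) := Algebra.adjoin ℂ (Set.range expFn)

lemma expFn_mem_trigPoly (ν : ℝ) : expFn ν ∈ trigPoly := Algebra.subset_adjoin ⟨ν, rfl⟩

/-- Exponentials are closed under products. The algebra form serves pull-backs of polynomials, the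
span form the termwise inversion of `U_S`. -/
lemma trigPoly_toSubmodule :
    Subalgebra.toSubmodule trigPoly = Submodule.span ℂ (Set.range expFn) := by
  refine Algebra.adjoin_eq_span_of_subset (R := ℂ) (s := Set.range expFn) ?_
  refine Set.Subset.trans (fun x => Submonoid.closure_induction (fun _ => id) ⟨0, expFn_zero⟩ ?_)
    Submodule.subset_span
  rintro _ _ _ _ ⟨ν, rfl⟩ ⟨ν', rfl⟩
  exact ⟨ν + ν', (expFn_mul ν ν').symm⟩

/-- Off resonance the integral stays bounded by `2 / ‖κ‖`, so its mean decays like `1 / T`. -/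
lemma isBohrCoeff_expFn (ν μ : ℝ) :
    IsBohrCoeff (fun c : ℝ => expFn ν c) μ (if μ = ν then 1 else 0) := by
  refine ⟨fun T => Continuous.intervalIntegrable (by unfold expFn; fun_prop) _ _, ?_⟩
  have h_int : ∀ c : ℝ, Complex.exp (-(Complex.I * μ * c / 2)) * expFn ν c =
      Complex.exp ((Complex.I * (ν - μ) / 2) * c) := fun c => by
    rw [expFn, ← Complex.exp_add]
    congr 1
    ring
  simp only [h_int]
  split_ifs with h
  · subst h
    refine tendsto_const_nhds.congr' ?_
    filter_upwards [Filter.eventually_gt_atTop 0] with T hT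
    have : (T : ℂ) ≠ 0 := by exact_mod_cast hT.ne'
    simp only [sub_self, mul_zero, zero_div, zero_mul, Complex.exp_zero,
      intervalIntegral.integral_const]
    rw [Complex.real_smul]
    push_cast
    field_simp
    ring
  · set κ : ℂ := Complex.I * (ν - μ) / 2 with hκ
    have hκ0 : κ ≠ 0 := by
      have : (ν : ℂ) - μ ≠ 0 := sub_ne_zero.mpr (fun e => h (Complex.ofReal_injective e).symm)
      simp [hκ, this]
    have hre : ∀ T : ℝ, ‖Complex.exp (κ * T)‖ = 1 := fun T => by
      have : κ * T = ((ν - μ) / 2 * T : ℝ) * Complex.I := by rw [hκ]; push_cast; ring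
      rw [this, Complex.norm_exp_ofReal_mul_I]
    have hlim : Filter.Tendsto (fun T : ℝ => (2 * T)⁻¹ * (2 / ‖κ‖)) Filter.atTop (nhds 0) := by
      have h2 : Filter.Tendsto (fun T : ℝ => 2 * T) Filter.atTop Filter.atTop :=
        Filter.tendsto_id.const_mul_atTop two_pos
      simpa using (tendsto_inv_atTop_zero.comp h2).mul_const (2 / ‖κ‖)
    refine squeeze_zero_norm' ?_ hlim
    filter_upwards [Filter.eventually_gt_atTop 0] with T hT
    rw [integral_exp_mul_complex hκ0, norm_mul, norm_inv, Complex.norm_real,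
      Real.norm_of_nonneg (by positivity), norm_div]
    gcongr
    refine (norm_sub_le _ _).trans ?_
    rw [hre, hre]
    norm_num

lemma entry_mem_Cyl (e : StraightEdge) (i j : Fin 2) :
    (fun A : GenConn SU2 => A.toFun e.toCurve i j) ∈ Cyl := by
  let L : (Fin 1 → Mat) →L[ℝ] ℂ :=
    ⟨{ toFun := fun g => g 0 i j, map_add' := fun _ _ => rfl, map_smul' := fun _ _ => rfl },
      (continuous_apply 0).matrix_elem i j⟩
  exact ⟨1, fun _ => e, L, L.analyticOn _, fun _ => rfl⟩

/-- For an edge along the third axis `rotMat` is diagonal with entries `ζ⁻¹` and `ζ`. Length `|ν /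
a|` gives the frequency up to sign, and the sign selects the entry; `ν = 0` is separate because
edges have positive length. -/
lemma expFn_mem_CylS {A₀ : SmoothConn} {a : ℝ} (ha : ∀ x v, A₀.1 x v = a • v) (ha0 : a ≠ 0)
    (ν : ℝ) : (fun c : ℝ => expFn ν c) ∈ CylS A₀ := by
  rcases eq_or_ne ν 0 with rfl | hν
  · refine ⟨fun _ => 1, ⟨0, Fin.elim0, fun _ => 1, analyticOn_const, fun _ => rfl⟩, ?_⟩
    funext c
    simp [LinearMap.funLeft_apply, expFn]
  set L : ℝ := |ν / a| with hL
  have hLpos : 0 < L := abs_pos.mpr (div_ne_zero hν ha0)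
  let v : Space := EuclideanSpace.single 2 L
  have hv : (0 : Space) ≠ v := fun h => hLpos.ne' (by
    simpa [v] using (congrArg (fun x : Space => x 2) h).symm)
  let e : StraightEdge := ⟨0, v, hv⟩
  have hdir : e.dir = v := sub_zero v
  have hnorm : ‖v‖ = L := by
    exact (PiLp.norm_single 2 (fun _ : Fin 3 => ℝ) 2 L).trans (Real.norm_of_nonneg hLpos.le)
  have hL0 : (L : ℂ) ≠ 0 := by exact_mod_cast hLpos.ne'
  have h11 : ∀ ζ : ℂ, rotMat v ζ 1 1 = ζ := fun ζ => by
    have hI := Complex.I_ne_zero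
    have hv2 : v 2 = L := by simp [v]
    simp only [rotMat, hnorm, dirMat_eq, hv2, Matrix.add_apply, Matrix.smul_apply,
      Matrix.one_apply_eq, smul_eq_mul]
    simp only [Matrix.of_apply, Matrix.cons_val_one, Matrix.cons_val_fin_one]
    generalize ζ⁻¹ = ξ
    field_simp
    ring
  have h00 : ∀ ζ : ℂ, rotMat v ζ 0 0 = ζ⁻¹ := fun ζ => by
    have hI := Complex.I_ne_zero
    have hv2 : v 2 = L := by simp [v]
    simp only [rotMat, hnorm, dirMat_eq, hv2, Matrix.add_apply, Matrix.smul_apply,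
      Matrix.one_apply_eq, smul_eq_mul]
    simp only [Matrix.of_apply, Matrix.cons_val_zero]
    generalize ζ⁻¹ = ξ
    field_simp
    ring
  rcases le_or_gt 0 (ν / a) with hs | hs
  · have haL : a * L = ν := by rw [hL, abs_of_nonneg hs, mul_div_cancel₀ _ ha0]
    refine ⟨_, entry_mem_Cyl e 1 1, ?_⟩
    funext c
    simp only [LinearMap.funLeft_apply, symmConn_straightEdge ha, hdir, h11, edgePhase, hnorm, haL,
      expFn]
  · have haL : a * L = -ν := by rw [hL, abs_of_neg hs, mul_neg, mul_div_cancel₀ _ ha0]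
    refine ⟨_, entry_mem_Cyl e 0 0, ?_⟩
    funext c
    simp only [LinearMap.funLeft_apply, symmConn_straightEdge ha, hdir, h00, edgePhase, hnorm, haL,
      expFn, ← Complex.exp_neg]
    congr 1
    push_cast
    ring

/-- Every trigonometric polynomial is in the range of the transform of loop quantum cosmology. -/
lemma exists_holTransformS {A₀ : SmoothConn} {a : ℝ} (ha : ∀ x v, A₀.1 x v = a • v) (ha0 : a ≠ 0)
    (G γ : ℝ) (CS : ℝ → ℝ) {w : ℂ → ℂ} (hw : w ∈ trigPoly) :
    ∃ φ, (φ, w) ∈ holTransformS G γ A₀ CS := by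
  have hle : Submodule.span ℂ (Set.range expFn) ≤
      (holTransformS G γ A₀ CS).map (LinearMap.snd ℂ (CylS A₀) (ℂ → ℂ)) := by
    rw [Submodule.span_le]
    rintro _ ⟨ν, rfl⟩
    have hmem := expFn_mem_CylS ha ha0 ν
    -- The inverse of the multiplier on the eigenvector `e^{iνc/2}`.
    set k : ℂ := ((Real.exp (CS (8 * Real.pi * γ * G / 3 * (ν / 2))) : ℝ) : ℂ) with hk
    refine ⟨(k • ⟨_, hmem⟩, expFn ν), ⟨?_, hmem, fun μ => ?_⟩, rfl⟩
    · change Differentiable ℂ fun z => Complex.exp (Complex.I * ν * z / 2)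
      fun_prop
    · have h := isBohrCoeff_expFn ν μ
      refine ⟨_, h.smul k, ?_⟩
      convert h using 1
      split_ifs with hμν
      · rw [hμν, hk, mul_one, ← Complex.ofReal_mul, ← Real.exp_add]
        simp
      · simp
  have hw' : w ∈ Submodule.span ℂ (Set.range expFn) := by
    rw [← trigPoly_toSubmodule]; exact hw
  obtain ⟨⟨φ, w'⟩, hmem, rfl⟩ := hle hw'
  exact ⟨φ, hmem⟩

lemma entry_mem_trigPoly {A₀ : SmoothConn} {a : ℝ} (ha : ∀ x v, A₀.1 x v = a • v)
    {s : ℂ → SmoothConnC} (hs : ∀ z, (s z).1 = scaledForm A₀ z) (e : StraightEdge) (i j : Fin 2) :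
    (fun z => (viaHolonomies s z).toFun e.toCurve i j) ∈ trigPoly := by
  set ν := a * ‖e.dir‖ with hν
  have h : (fun z => (viaHolonomies s z).toFun e.toCurve i j) =
      ((1 : Mat) i j / 2 + dirMat e.dir i j / (Complex.I * ‖e.dir‖)) • expFn ν +
      ((1 : Mat) i j / 2 - dirMat e.dir i j / (Complex.I * ‖e.dir‖)) • expFn (-ν) := by
    funext z
    have hinv : expFn (-ν) z = (expFn ν z)⁻¹ := by
      simp only [expFn, ← Complex.exp_neg]
      congr 1
      push_cast
      ring
    simp only [viaHolonomies_straightEdge ha hs, Pi.add_apply, Pi.smul_apply, smul_eq_mul, hinv,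
      rotMat, Matrix.add_apply, Matrix.smul_apply]
    change (edgePhase a e z + (edgePhase a e z)⁻¹) / 2 * _ +
      (edgePhase a e z - (edgePhase a e z)⁻¹) / _ * _ = _ * edgePhase a e z +
      _ * (edgePhase a e z)⁻¹
    ring
  rw [h]
  exact add_mem (Subalgebra.smul_mem _ (expFn_mem_trigPoly _) _)
    (Subalgebra.smul_mem _ (expFn_mem_trigPoly _) _)

lemma IsPolyCyl.comp_mem_trigPoly {A₀ : SmoothConn} {a : ℝ} (ha : ∀ x v, A₀.1 x v = a • v)
    {s : ℂ → SmoothConnC} (hs : ∀ z, (s z).1 = scaledForm A₀ z) {W : GenConn SL2 → ℂ}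
    (hW : IsPolyCyl W) : W ∘ viaHolonomies s ∈ trigPoly := by
  obtain ⟨n, e, P, hP⟩ := hW
  have h : W ∘ viaHolonomies s = fun z => MvPolynomial.eval
      (fun k => (viaHolonomies s z).toFun (e k.1).toCurve k.2.1 k.2.2) P := funext fun z => hP _
  rw [h]
  clear h hP
  induction P using MvPolynomial.induction_on with
  | C c =>
    simp only [MvPolynomial.eval_C]
    exact trigPoly.algebraMap_mem c
  | add P Q hP hQ =>
    simp only [map_add]
    exact trigPoly.add_mem hP hQ
  | mul_X P k hP =>
    simp only [map_mul, MvPolynomial.eval_X]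
    exact trigPoly.mul_mem hP (entry_mem_trigPoly ha hs _ _ _)

/-- Pull-backs of holomorphic cylindrical functions are holomorphic functions of finitely many
exponentials. -/
lemma HolCyl.isHolCylS {A₀ : SmoothConn} {a : ℝ} (ha : ∀ x v, A₀.1 x v = a • v)
    {s : ℂ → SmoothConnC} (hs : ∀ z, (s z).1 = scaledForm A₀ z) {F : GenConn SL2 → ℂ}
    (hF : F ∈ HolCyl) : IsHolCylS (F ∘ viaHolonomies s) := by
  obtain ⟨n, e, f, hf, hFf⟩ := hF
  refine ⟨n, fun j => a * ‖(e j).dir‖, fun ζ => f fun j => rotMat (e j).dir (ζ j), ?_, fun z => ?_⟩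
  · refine hf.differentiableOn.comp (differentiableOn_pi.mpr fun j => ?_)
      fun ζ hζ j => rotMat_mem_SL2 (e j).dir_ne (hζ j)
    have h1 : DifferentiableOn ℂ (fun ζ : Fin n → ℂ => ζ j) {ζ | ∀ j, ζ j ≠ 0} := by fun_prop
    have h2 : DifferentiableOn ℂ (fun ζ : Fin n → ℂ => (ζ j)⁻¹) {ζ | ∀ j, ζ j ≠ 0} :=
      h1.inv fun ζ hζ => hζ j
    simp only [rotMat, div_eq_mul_inv]
    exact (((h1.add h2).mul_const _).smul_const (1 : Mat)).add
      (((h1.sub h2).mul_const _).smul_const (dirMat (e j).dir))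
  · simp only [Function.comp_apply, hFf, viaHolonomies_straightEdge ha hs]
    rfl

end

end LoopQG

/-! ### Assembly of the proposition -/

theorem proposition2
    (G γ ℓ : ℝ) (hG : 0 < G) (hγ : 0 < γ) (hℓ : 0 < ℓ)
    (A₀ : SmoothConn) (hinv : IsEuclideanInvariant A₀.1) (hA₀ : A₀.1 ≠ 0)
    (μ : MeasureTheory.Measure (GenConn SU2)) (hμ : IsAshtekarLewandowski μ)
    (C : RealForm → ℝ) (hC : ∀ E, 0 ≤ C E)
    (dC : ℝ → SmoothConn) (hdC : ∀ p, HasFunctionalDeriv C (symmTriad ℓ A₀ p) (dC p))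
    (hdC0 : ∀ p, (dC p).1 = 0 ↔ p = 0)
    (Chat : Hilb μ →ₗ.[ℂ] Hilb μ) (hsa : IsSelfAdjoint Chat)
    (hpos : ∀ x : Chat.domain, 0 ≤ (inner ℂ (x : Hilb μ) (Chat x)).re)
    (CS : ℝ → ℝ) (hCS : ∀ p, 0 ≤ CS p) (hCSd : Differentiable ℝ CS)
    (hCS0 : ∀ p, deriv CS p = 0 ↔ p = 0)
    (s : ℂ → SmoothConnC)
    (hs : ∀ c p : ℝ, (s (zCoord G γ CS c p)).1 = complexConn G γ A₀ c (dC p))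
    (hshol : IsHolomorphicMap s)
    (F : GenConn SL2 → ℂ) (hF : F ∈ HolCyl) :
    IsHolCylS (F ∘ viaHolonomies s) ∧
    (bProj G γ A₀ μ Chat CS s).graph = bProjGraph G γ A₀ μ Chat CS s ∧
    (quantized μ Chat F).graph = mulGraph (holTransform μ Chat) F ∧
    (quantizedS G γ A₀ CS (F ∘ viaHolonomies s)).graph =
      mulGraph (holTransformS G γ A₀ CS) (F ∘ viaHolonomies s) ∧
    (∀ ψ : Module.Dual ℂ (CylS A₀),
      (dualAct (quantized μ Chat F)
          (bEmbed G γ A₀ μ Chat CS s (ψ.toPMap ⊤))).domRestrict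
        (bProj G γ A₀ μ Chat CS s).domain =
      (bEmbed G γ A₀ μ Chat CS s
          (dualAct (quantizedS G γ A₀ CS (F ∘ viaHolonomies s)) (ψ.toPMap ⊤))).domRestrict
        (quantized μ Chat F).domain) ∧
    (∀ (Φ : Cyl) (W : GenConn SL2 → ℂ), (Φ, W) ∈ holTransform μ Chat → IsPolyCyl W →
      Φ ∈ (bProj G γ A₀ μ Chat CS s).domain ∧
      (IsPolyCyl F → ∀ ψ : Module.Dual ℂ (CylS A₀),
        Φ ∈ (bEmbed G γ A₀ μ Chat CS s
          (dualAct (quantizedS G γ A₀ CS (F ∘ viaHolonomies s)) (ψ.toPMap ⊤))).domain)) := by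
  obtain ⟨a, ha⟩ := eq_smul_of_isEuclideanInvariant hinv
  have ha0 : a ≠ 0 := by
    rintro rfl
    refine hA₀ (funext fun x => ContinuousLinearMap.ext fun v => ?_)
    rw [ha, zero_smul]
    rfl
  -- Only the points with `p = 0` are used: there both imaginary parts vanish, so `z = c` and the
  -- complex connection is `c Å`.
  have hsc : ∀ c : ℝ, (s c).1 = scaledForm A₀ c := by
    intro c
    have hz : zCoord G γ CS c 0 = c := by simp [zCoord, (hCS0 0).mpr rfl]
    have h := hs c 0
    rw [hz] at h
    rw [h]
    funext x
    ext v i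
    simp [complexConn, (hdC0 0).mpr rfl, toComplexForm]
  have hsz := eq_scaledForm hsc hshol
  have hU₁ : ∀ W, ((0 : Cyl), W) ∈ holTransform μ Chat → W = 0 :=
    fun W => holTransform_eq_zero_of_fst hμ hpos
  have hgπ := bProj_graph (G := G) (γ := γ) ha hμ hpos CS s
  have hgF : (quantized μ Chat F).graph = mulGraph (holTransform μ Chat) F :=
    mulGraph_toLinearPMap_graph hU₁ (fun Φ => holTransform_eq_zero_of_snd hμ hsa) F
  have hgS : (quantizedS G γ A₀ CS (F ∘ viaHolonomies s)).graph =
      mulGraph (holTransformS G γ A₀ CS) (F ∘ viaHolonomies s) :=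
    mulGraph_toLinearPMap_graph (fun w => holTransformS_eq_zero_of_fst ha)
      (fun φ => holTransformS_eq_zero_of_snd ha) _
  refine ⟨HolCyl.isHolCylS ha hsz hF, hgπ, hgF, hgS, fun ψ => ?_, fun Φ W hW hWp => ?_⟩
  -- Equality of graphs expresses at once that one side is defined exactly when the other is and
  -- that the values agree.
  · refine LinearPMap.eq_of_eq_graph ?_
    ext ⟨Φ, y⟩
    simp only [mem_graph_domRestrict, mem_graph_dualAct, bEmbed, mem_graph_toPMap_top,
      LinearPMap.mem_domain_iff, hgπ, hgF, hgS]
    constructor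
    -- The restriction to the domain of `π` supplies `φ = π Φ`, the intermediate vector of the other
    -- side. Uniqueness of `U` identifies the transforms, and `(F * W₀) ∘ s` is `(F ∘ s) * (W₀ ∘ s)`
    -- by definition.
    · rintro ⟨⟨φ, W₀, hW₀, hφ⟩, Φ', ⟨W, hW, hFW⟩, φ', ⟨W', hW', hφ'⟩, rfl⟩
      obtain rfl := holTransform_unique hμ hpos hW₀ hW
      obtain rfl := holTransform_unique hμ hpos hW' hFW
      exact ⟨⟨Φ', W₀, hW₀, hFW⟩, φ, ⟨W₀, hW₀, hφ⟩, φ', ⟨_, hφ, hφ'⟩, rfl⟩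
    -- Here the domain of `F(𝔷̂)` supplies `Φ'`, and uniqueness of `U_S` gives `w = W₀ ∘ s`.
    · rintro ⟨⟨Φ', W₀, hW₀, hFW⟩, φ, ⟨W, hW, hφ⟩, φ', ⟨w, hw, hφ'⟩, rfl⟩
      obtain rfl := holTransform_unique hμ hpos hW₀ hW
      obtain rfl := holTransformS_unique ha hw hφ
      exact ⟨⟨φ, W₀, hW₀, hφ⟩, Φ', ⟨W₀, hW₀, hFW⟩, φ', ⟨_, hFW, hφ'⟩, rfl⟩
  · have hWt := hWp.comp_mem_trigPoly ha hsz
    obtain ⟨φ, hφ⟩ := exists_holTransformS ha ha0 G γ CS hWt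
    have hπ : (Φ, φ) ∈ (bProj G γ A₀ μ Chat CS s).graph := by
      rw [hgπ]
      exact ⟨W, hW, hφ⟩
    refine ⟨LinearPMap.mem_domain_iff.mpr ⟨φ, hπ⟩, fun hFp ψ => ?_⟩
    -- The product of two trigonometric polynomials is again one, so `(F ∘ s) · U_S φ` has a
    -- preimage under `U_S`.
    obtain ⟨φ', hφ'⟩ := exists_holTransformS ha ha0 G γ CS
      (trigPoly.mul_mem (hFp.comp_mem_trigPoly ha hsz) hWt)
    refine LinearPMap.mem_domain_iff.mpr ⟨ψ φ', mem_graph_dualAct.mpr ⟨φ, hπ,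
      mem_graph_dualAct.mpr ⟨φ', ?_, (mem_graph_toPMap_top ψ φ' _).mpr rfl⟩⟩⟩
    rw [hgS]
    exact ⟨_, hφ, hφ'⟩
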